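/- Let $\mathbb O$ be the octonions, written as $\mathbb O=\mathbf C\oplus\mathbf C^3$, where $\mathbf C=\mathbb R\oplus\mathbb R e_1$, with $(a+m)(b+n)=(ab-{}^tm\bar n)+(an+\bar bm+\overline{m\times n})$ and $\overline{a+m}=\bar a-m$. Let $\mathfrak J$ be the real vector space of Hermitian $3\times3$ octonion matrices $$\begin{pmatrix}\xi_1&x_3&\bar x_2\\ \bar x_3&\xi_2&x_1\\ x_2&\bar x_1&\xi_3\end{pmatrix},\qquad \xi_k\in\mathbb R,\ x_k=a_k+m_k\in\mathbb O,$$ with $X\circ Y=\tfrac12(XY+YX)$, $(X,Y)=\operatorname{tr}(X\circ Y)$ and Freudenthal product $$X\times Y=\tfrac12\bigl(2X\circ Y-\operatorname{tr}(X)Y-\operatorname{tr}(Y)X+(\operatorname{tr}(X)\operatorname{tr}(Y)-(X,Y))E\bigr).$$ Identify $\mathfrak J=\mathfrak J_{\mathbf C}\oplus M(3,\mathbf C)$, where $\mathfrak J_{\mathbf C}$ is the space of Hermitian $3\times 3$ matrices over $\mathbf C$: an element corresponds to $X+M$, where $X$ is formed from the $\xi_k,a_k$ and $M=(m_1,m_2,m_3)$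 has columns $m_k$. Put $$\gamma(X+M)=X+\operatorname{diag}(1,-1,-1)M,\qquad \gamma'(X+M)=X+\operatorname{diag}(-1,1,-1)M,\qquad \gamma_1(X+M)=\overline X+\overline M,$$ $$\sigma(X+M)=DXD+MD,\quad D=\operatorname{diag}(1,-1,-1);\qquad \sigma'(X+M)=D'XD'+MD',\quad D'=\operatorname{diag}(-1,-1,1).$$ Let $\mathfrak J^C=\mathfrak J\otimes_{\mathbb R}\mathbb C$, let $\tau$ be its complex conjugation with respect to $\mathfrak J$, extend $\times$ and $(\cdot,\cdot)$ complex bilinearly, put $\langle X,Y\rangle=(\tau X,Y)$, and extend $\gamma,\gamma',\gamma_1,\sigma,\sigma'$ complex linearly. Let $E_6$ be the topological group $$E_6=\{\alpha\in \mathrm{GL}_{\mathbb C}(\mathfrak J^C)\mid \alpha X\times\alpha Y=\tau\alpha\tau(X\times Y),\ \langle\alpha X,\alpha Y\rangle=\langle X,Y\rangle\ \text{for all } X,Y\in\mathfrak J^C\}.$$ **Theorem.** The maps $\gamma,\gamma',\sigma,\sigma'$ lie in $E_6$. Let $(E_6)^{\gamma,\gamma',\sigma,\sigma'}$ be the subgroup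 of all elements of $E_6$ that commute with $\gamma,\gamma',\sigma$ and $\sigma'$. Then: 1. its identity component is isomorphic, as a topological group, to the torus $U(1)^{\times 6}$; 2. this identity component is a maximal torus of $E_6$ (a subgroup isomorphic as a topological group to some $U(1)^{\times n}$, and contained in no larger such subgroup); 3. there is an isomorphism of topological groups $$(E_6)^{\gamma,\gamma',\sigma,\sigma'}\cong U(1)^{\times 6}\rtimes\mathbb Z_2,$$ where the nontrivial element of $\mathbb Z_2$ acts by $(p,q,a_1,a_2,a_3,a_4)\mapsto(\bar p,\bar q,\bar a_3,\bar a_4,\bar a_1,\bar a_2)$ and corresponds to $\gamma_1$. -/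

import Mathlib

open scoped Matrix

noncomputable section

namespace ExcE6

/-! ### Octonions over a field `R`

For `R = ℝ` these are the (division) octonions; for `R = ℂ` they are the complexified octonions. -/

/-- `R[e₁]` with `e₁² = -1`. For `R = ℝ` this is the field of complex numbers (with imaginary unit
`e₁`), for `R = ℂ` its complexification, in which `e₁` differs from the scalar `i ∈ ℂ`.
`star` is the `R`-linear conjugation `e₁ ↦ -e₁`. -/
abbrev Cx (R : Type*) [Field R] := QuadraticAlgebra R (-1) 0

/-- The octonions over `R`, written as `R[e₁] ⊕ R[e₁]³`; an element is `a + m`,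
with `a` the field `sc` and `m = (m₁, m₂, m₃)` the field `vec`. -/
@[ext]
structure Oct (R : Type*) [Field R] where
  sc : Cx R
  vec : Fin 3 → Cx R

namespace Oct

variable {R : Type*} [Field R]

/-- An octonion as a pair. -/
def equivProd : Oct R ≃ Cx R × (Fin 3 → Cx R) where
  toFun x := (x.sc, x.vec)
  invFun p := ⟨p.1, p.2⟩
  left_inv _ := rfl
  right_inv _ := rfl

instance : Zero (Oct R) := ⟨⟨0, 0⟩⟩
instance : Add (Oct R) := ⟨fun x y => ⟨x.sc + y.sc, x.vec + y.vec⟩⟩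
instance : Neg (Oct R) := ⟨fun x => ⟨-x.sc, -x.vec⟩⟩
instance : Sub (Oct R) := ⟨fun x y => ⟨x.sc - y.sc, x.vec - y.vec⟩⟩
instance {S : Type*} [SMul S R] : SMul S (Oct R) := ⟨fun r x => ⟨r • x.sc, r • x.vec⟩⟩

@[simp] theorem zero_sc : (0 : Oct R).sc = 0 := rfl
@[simp] theorem zero_vec : (0 : Oct R).vec = 0 := rfl
@[simp] theorem add_sc (x y : Oct R) : (x + y).sc = x.sc + y.sc := rfl
@[simp] theorem add_vec (x y : Oct R) : (x + y).vec = x.vec + y.vec := rfl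
@[simp] theorem neg_sc (x : Oct R) : (-x).sc = -x.sc := rfl
@[simp] theorem neg_vec (x : Oct R) : (-x).vec = -x.vec := rfl
@[simp] theorem sub_sc (x y : Oct R) : (x - y).sc = x.sc - y.sc := rfl
@[simp] theorem sub_vec (x y : Oct R) : (x - y).vec = x.vec - y.vec := rfl
@[simp] theorem smul_sc {S : Type*} [SMul S R] (r : S) (x : Oct R) :
    (r • x).sc = r • x.sc := rfl
@[simp] theorem smul_vec {S : Type*} [SMul S R] (r : S) (x : Oct R) :
    (r • x).vec = r • x.vec := rfl

instance : AddCommGroup (Oct R) :=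
  Function.Injective.addCommGroup (equivProd (R := R)) equivProd.injective rfl
    (fun _ _ => rfl) (fun _ => rfl) (fun _ _ => rfl) (fun _ _ => rfl) (fun _ _ => rfl)

instance : Module R (Oct R) :=
  Function.Injective.module R
    { toFun := equivProd (R := R), map_zero' := rfl, map_add' := fun _ _ => rfl }
    equivProd.injective (fun _ _ => rfl)

/-- `1 = 1 + 0`. -/
instance : One (Oct R) := ⟨⟨1, 0⟩⟩

/-- Octonion conjugation `a + m ↦ ā - m`. -/
instance : Star (Oct R) := ⟨fun x => ⟨star x.sc, -x.vec⟩⟩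

/-- Octonion multiplication
`(a + m)(b + n) = (ab - ᵗm n̄) + (a n + b̄ m + conj (m × n))`. -/
instance : Mul (Oct R) :=
  ⟨fun x y => ⟨x.sc * y.sc - x.vec ⬝ᵥ star y.vec,
    x.sc • y.vec + star y.sc • x.vec + star (x.vec ⨯₃ y.vec)⟩⟩

theorem mul_def (x y : Oct R) : x * y = ⟨x.sc * y.sc - x.vec ⬝ᵥ star y.vec,
    x.sc • y.vec + star y.sc • x.vec + star (x.vec ⨯₃ y.vec)⟩ := rfl

@[simp] theorem one_sc : (1 : Oct R).sc = 1 := rfl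
@[simp] theorem one_vec : (1 : Oct R).vec = 0 := rfl
@[simp] theorem star_sc (x : Oct R) : (star x).sc = star x.sc := rfl
@[simp] theorem star_vec (x : Oct R) : (star x).vec = -x.vec := rfl

instance : NonUnitalNonAssocRing (Oct R) where
  left_distrib x y z := by
    ext1
    · simp [mul_def, mul_add, dotProduct_add]; ring
    · simp [mul_def, smul_add, add_smul]; abel
  right_distrib x y z := by
    ext1
    · simp [mul_def, add_mul, add_dotProduct]; ring
    · simp [mul_def, smul_add, add_smul]; abel
  zero_mul x := by ext1 <;> simp [mul_def]
  mul_zero x := by ext1 <;> simp [mul_def]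

theorem star_add' (x y : Oct R) : star (x + y) = star x + star y := by
  ext1
  · simp
  · simp [add_comm]

theorem star_smul' (r : R) (x : Oct R) : star (r • x) = r • star x := by
  ext1
  · ext <;> simp
  · simp

theorem star_mul' (x y : Oct R) : star (x * y) = star y * star x := by
  ext1
  · simp [mul_def, dotProduct, Fin.sum_univ_three]; ring
  · funext k
    fin_cases k <;> simp [mul_def, cross_apply] <;> ring

/-- The coordinates over `R` of an octonion. -/
def coordHom : Oct R →ₗ[R] (R × R) × (Fin 3 → R × R) where
  toFun x := ((x.sc.re, x.sc.im), fun k => ((x.vec k).re, (x.vec k).im))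
  map_add' _ _ := rfl
  map_smul' _ _ := rfl

theorem coordHom_injective : Function.Injective (coordHom (R := R)) := by
  intro x y h
  simp only [coordHom, LinearMap.coe_mk, AddHom.coe_mk, Prod.mk.injEq, funext_iff] at h
  ext1
  · exact QuadraticAlgebra.ext h.1.1 h.1.2
  · funext k
    exact QuadraticAlgebra.ext (h.2 k).1 (h.2 k).2

instance : FiniteDimensional R (Oct R) :=
  FiniteDimensional.of_injective coordHom coordHom_injective

/-- The norm only serves to topologize a finite-dimensional space; any norm would do. -/
instance : NormedAddCommGroup (Oct ℂ) :=
  NormedAddCommGroup.induced (Oct ℂ) ((ℂ × ℂ) × (Fin 3 → ℂ × ℂ)) coordHom coordHom_injective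

instance : NormedSpace ℂ (Oct ℂ) :=
  NormedSpace.induced ℂ (Oct ℂ) ((ℂ × ℂ) × (Fin 3 → ℂ × ℂ)) coordHom

/-- The standard quadratic norm of the octonions. -/
def normSq (x : Oct R) : R := x.sc.norm + ∑ k, (x.vec k).norm

/-- The octonions form a composition algebra. -/
theorem normSq_mul (x y : Oct R) : normSq (x * y) = normSq x * normSq y := by
  simp [normSq, mul_def, QuadraticAlgebra.norm_def, Fin.sum_univ_three, cross_apply, dotProduct]
  ring

end Oct

/-! ### The exceptional Jordan algebra -/

/-- The space of Hermitian `3 × 3` octonion matrices over `R`: the pair `(ξ, x)` stands for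
`(ξ₁ x₃ x̄₂; x̄₃ ξ₂ x₁; x₂ x̄₁ ξ₃)`, see `toMatrix`. For `R = ℝ` this is `𝔍`, and for `R = ℂ`
it is the complexification `𝔍^C`. In the decomposition `𝔍 = 𝔍_C ⊕ M(3, C)`, `X + M`, the
octonion `x_j` is `a_j + m_j`, where the `a_j` (with `ξ`) are the entries of `X` and
`m₁, m₂, m₃` are the columns of `M`, see `cPart` and `mPart`. -/
abbrev Alb (R : Type*) [Field R] := (Fin 3 → R) × (Fin 3 → Oct R)

namespace Alb

variable {R : Type*} [Field R]

/-- The Hermitian octonion matrix with coordinates `(ξ, x)`. -/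
def toMatrix (X : Alb R) : Matrix (Fin 3) (Fin 3) (Oct R) :=
  !![X.1 0 • (1 : Oct R), X.2 2, star (X.2 1);
     star (X.2 2), X.1 1 • (1 : Oct R), X.2 0;
     X.2 1, star (X.2 0), X.1 2 • (1 : Oct R)]

/-- The coordinates of a Hermitian octonion matrix. -/
def ofMatrix (A : Matrix (Fin 3) (Fin 3) (Oct R)) : Alb R :=
  (fun k => (A k k).sc.re, ![A 1 2, A 2 0, A 0 1])

theorem ofMatrix_toMatrix (X : Alb R) : ofMatrix (toMatrix X) = X := by
  refine Prod.ext ?_ ?_ <;> funext k <;> fin_cases k <;>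
    simp [ofMatrix, toMatrix, QuadraticAlgebra.re_one]

theorem star_toMatrix (X : Alb R) (i j : Fin 3) :
    star (toMatrix X i j) = toMatrix X j i := by
  fin_cases i <;> fin_cases j <;> simp [toMatrix, Oct.ext_iff, QuadraticAlgebra.ext_iff,
    QuadraticAlgebra.im_one]

/-- `ofMatrix` loses no information on Hermitian matrices. -/
theorem toMatrix_ofMatrix [NeZero (2 : R)] {A : Matrix (Fin 3) (Fin 3) (Oct R)}
    (hA : ∀ i j, star (A i j) = A j i) : toMatrix (ofMatrix A) = A := by
  have h2 : (2 : R) ≠ 0 := NeZero.ne 2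
  have half : ∀ r : R, -r = r → r = 0 := fun r hr => by
    have h : (2 : R) * r = 0 := by linear_combination -hr
    exact (mul_eq_zero.1 h).resolve_left h2
  have diag : ∀ k, (A k k).sc.re • (1 : Oct R) = A k k := fun k => by
    have h := hA k k
    rw [Oct.ext_iff] at h
    refine Oct.ext (QuadraticAlgebra.ext ?_ ?_) (funext fun l => QuadraticAlgebra.ext ?_ ?_)
    · simp [QuadraticAlgebra.re_one]
    · have := congrArg QuadraticAlgebra.im h.1
      simp only [Oct.star_sc, QuadraticAlgebra.im_star] at this
      simp [half _ this, QuadraticAlgebra.im_one]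
    · have := congrArg QuadraticAlgebra.re (congrFun h.2 l)
      simp only [Oct.star_vec, Pi.neg_apply, QuadraticAlgebra.re_neg] at this
      simp [half _ this]
    · have := congrArg QuadraticAlgebra.im (congrFun h.2 l)
      simp only [Oct.star_vec, Pi.neg_apply, QuadraticAlgebra.im_neg] at this
      simp [half _ this]
  ext1 i j
  fin_cases i <;> fin_cases j <;> simp [toMatrix, ofMatrix, diag, hA]

/-- The component `X ∈ 𝔍_C` of an element `X + M`. -/
def cPart (X : Alb R) : Matrix (Fin 3) (Fin 3) (Cx R) :=
  (toMatrix X).map Oct.sc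

/-- The component `M ∈ M(3, C)` of an element `X + M`. -/
def mPart (X : Alb R) : Matrix (Fin 3) (Fin 3) (Cx R) :=
  Matrix.of fun k j => (X.2 j).vec k

/-- The Jordan product `X ∘ Y = (XY + YX) / 2`. -/
def jordan (X Y : Alb R) : Alb R :=
  ofMatrix ((1 / 2 : R) • (toMatrix X * toMatrix Y + toMatrix Y * toMatrix X))

/-- `jordan` really is the symmetrized matrix product. -/
theorem toMatrix_jordan [NeZero (2 : R)] (X Y : Alb R) : toMatrix (jordan X Y) =
    (1 / 2 : R) • (toMatrix X * toMatrix Y + toMatrix Y * toMatrix X) := by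
  refine toMatrix_ofMatrix fun i j => ?_
  simp only [Matrix.smul_apply, Matrix.add_apply, Matrix.mul_apply, Fin.sum_univ_three,
    Oct.star_smul', Oct.star_add', Oct.star_mul', star_toMatrix]
  congr 1
  abel

/-- The trace of an element. -/
def tr (X : Alb R) : R := ∑ k, X.1 k

/-- The unit matrix `E`. -/
def unitE : Alb R := (1, 0)

/-- The bilinear form `(X, Y) = tr (X ∘ Y)`. -/
def form (X Y : Alb R) : R := tr (jordan X Y)

/-- The Freudenthal product
`X × Y = (2 X ∘ Y - tr(X) Y - tr(Y) X + (tr(X) tr(Y) - (X, Y)) E) / 2`. -/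
def freudenthal (X Y : Alb R) : Alb R :=
  (1 / 2 : R) • ((2 : R) • jordan X Y - tr X • Y - tr Y • X + (tr X * tr Y - form X Y) • unitE)

/-! ### The linear maps `γ`, `γ'`, `γ₁`, `σ`, `σ'`

They are defined over every `R` by the same formulas; over `ℂ` they are the `ℂ`-linear extensions
of those over `ℝ`. -/

/-- `X + M ↦ X + diag(g) M`. -/
def rowSign (g : Fin 3 → R) : Alb R →ₗ[R] Alb R where
  toFun X := (X.1, fun j => ⟨(X.2 j).sc, fun k => g k • (X.2 j).vec k⟩)
  map_add' X Y := by
    refine Prod.ext rfl (funext fun j => Oct.ext rfl (funext fun k => ?_))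
    exact smul_add _ _ _
  map_smul' r X := by
    refine Prod.ext rfl (funext fun j => Oct.ext rfl (funext fun k => ?_))
    exact smul_comm (g k) r _

/-- `x_j ↦ s_j x_j` for the off-diagonal entries `x_j = a_j + m_j`; the diagonal is fixed. -/
def colSign (s : Fin 3 → R) : Alb R →ₗ[R] Alb R where
  toFun X := (X.1, fun j => s j • X.2 j)
  map_add' _ _ := Prod.ext rfl (funext fun _ => smul_add _ _ _)
  map_smul' r X := Prod.ext rfl (funext fun j => smul_comm (s j) r (X.2 j))

/-- `γ (X + M) = X + (γ m₁, γ m₂, γ m₃)`, `γ (n₁, n₂, n₃) = (n₁, -n₂, -n₃)`. -/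
def gamma : Alb R →ₗ[R] Alb R := rowSign ![1, -1, -1]

/-- `γ' (X + M) = X + (γ' m₁, γ' m₂, γ' m₃)`, `γ' (n₁, n₂, n₃) = (-n₁, n₂, -n₃)`. -/
def gamma' : Alb R →ₗ[R] Alb R := rowSign ![-1, 1, -1]

/-- `σ (X + M) = σ X + (m₁, -m₂, -m₃)`, where `σ X` has entries `x₁, -x₂, -x₃`. -/
def sigma : Alb R →ₗ[R] Alb R := colSign ![1, -1, -1]

/-- `σ' (X + M) = σ' X + (-m₁, -m₂, m₃)`, where `σ' X` has entries `-x₁, -x₂, x₃`. -/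
def sigma' : Alb R →ₗ[R] Alb R := colSign ![-1, -1, 1]

/-- `γ₁ (X + M) = X̄ + M̄`, the bar being `e₁ ↦ -e₁`. -/
def gamma1 : Alb R →ₗ[R] Alb R where
  toFun X := (X.1, fun j => ⟨star (X.2 j).sc, star (X.2 j).vec⟩)
  map_add' _ _ := Prod.ext rfl (funext fun _ => Oct.ext (star_add _ _) (star_add _ _))
  map_smul' r X := by
    refine Prod.ext rfl (funext fun j => Oct.ext ?_ (funext fun k => ?_)) <;>
    ext <;> simp

theorem cPart_gamma (X : Alb R) : cPart (gamma X) = cPart X := by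
  ext1 i j; fin_cases i <;> fin_cases j <;> simp [cPart, toMatrix, gamma, rowSign]

theorem mPart_gamma (X : Alb R) :
    mPart (gamma X) = Matrix.diagonal ![1, -1, -1] * mPart X := by
  ext1 i j; fin_cases i <;> simp [mPart, gamma, rowSign]

theorem cPart_gamma' (X : Alb R) : cPart (gamma' X) = cPart X := by
  ext1 i j; fin_cases i <;> fin_cases j <;> simp [cPart, toMatrix, gamma', rowSign]

theorem mPart_gamma' (X : Alb R) :
    mPart (gamma' X) = Matrix.diagonal ![-1, 1, -1] * mPart X := by
  ext1 i j; fin_cases i <;> simp [mPart, gamma', rowSign]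

theorem mPart_sigma (X : Alb R) :
    mPart (sigma X) = mPart X * Matrix.diagonal ![1, -1, -1] := by
  ext1 i j; fin_cases j <;> simp [mPart, sigma, colSign]

theorem mPart_sigma' (X : Alb R) :
    mPart (sigma' X) = mPart X * Matrix.diagonal ![-1, -1, 1] := by
  ext1 i j; fin_cases j <;> simp [mPart, sigma', colSign]

theorem rowSign_involutive {g : Fin 3 → R} (hg : ∀ k, g k * g k = 1) (X : Alb R) :
    rowSign g (rowSign g X) = X := by
  refine Prod.ext rfl (funext fun j => Oct.ext rfl (funext fun k => ?_))
  simp [rowSign, smul_smul, hg]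

theorem colSign_involutive {s : Fin 3 → R} (hs : ∀ k, s k * s k = 1) (X : Alb R) :
    colSign s (colSign s X) = X :=
  Prod.ext rfl (funext fun j => by simp [colSign, smul_smul, hs])

theorem gamma1_involutive (X : Alb R) : gamma1 (gamma1 X) = X :=
  Prod.ext rfl (funext fun _ => Oct.ext (star_star _) (star_star _))

end Alb

/-! ### The compact group `E₆` -/

/-- The complexified exceptional Jordan algebra `𝔍^C`. -/
abbrev JC := Alb ℂ

/-- The complex conjugation `τ` of `𝔍^C` with respect to `𝔍`: it conjugates all coordinates
(and fixes `e₁`). -/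
def tau (X : JC) : JC :=
  (star X.1, fun j => ⟨⟨star (X.2 j).sc.re, star (X.2 j).sc.im⟩,
    fun k => ⟨star ((X.2 j).vec k).re, star ((X.2 j).vec k).im⟩⟩)

@[simp] theorem tau_tau (X : JC) : tau (tau X) = X := by
  simp [tau]

/-- The inclusion `ℝ[e₁] → ℂ[e₁]`. -/
def Cx.ofReal (z : Cx ℝ) : Cx ℂ := ⟨z.re, z.im⟩

/-- The inclusion of the octonions into the complexified octonions. -/
def Oct.ofReal (x : Oct ℝ) : Oct ℂ := ⟨Cx.ofReal x.sc, fun k => Cx.ofReal (x.vec k)⟩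

/-- The inclusion `𝔍 → 𝔍^C`. -/
def Alb.ofReal (X : Alb ℝ) : JC := (fun k => (X.1 k : ℂ), fun j => Oct.ofReal (X.2 j))

/-- `𝔍^C` is the complexification of `𝔍`: every element is uniquely `X + iY` with `X, Y ∈ 𝔍`. -/
theorem existsUnique_add_I_smul (Z : JC) : ∃! p : Alb ℝ × Alb ℝ,
    Z = Alb.ofReal p.1 + Complex.I • Alb.ofReal p.2 := by
  refine ⟨((fun k => (Z.1 k).re, fun j => ⟨⟨(Z.2 j).sc.re.re, (Z.2 j).sc.im.re⟩,
      fun k => ⟨((Z.2 j).vec k).re.re, ((Z.2 j).vec k).im.re⟩⟩),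
    (fun k => (Z.1 k).im, fun j => ⟨⟨(Z.2 j).sc.re.im, (Z.2 j).sc.im.im⟩,
      fun k => ⟨((Z.2 j).vec k).re.im, ((Z.2 j).vec k).im.im⟩⟩)), ?_, ?_⟩
  · refine Prod.ext (funext fun k => ?_) (funext fun j => Oct.ext ?_ (funext fun k => ?_))
    · simp [Alb.ofReal, Complex.ext_iff]
    · simp [Alb.ofReal, Oct.ofReal, Cx.ofReal, QuadraticAlgebra.ext_iff, Complex.ext_iff]
    · simp [Alb.ofReal, Oct.ofReal, Cx.ofReal, QuadraticAlgebra.ext_iff, Complex.ext_iff]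
  · rintro p rfl
    refine Prod.ext ?_ ?_ <;>
    refine Prod.ext (funext fun k => ?_) (funext fun j => Oct.ext ?_ (funext fun k => ?_)) <;>
    simp [Alb.ofReal, Oct.ofReal, Cx.ofReal, QuadraticAlgebra.ext_iff]

theorem tau_ofReal (X : Alb ℝ) : tau (Alb.ofReal X) = Alb.ofReal X := by
  refine Prod.ext (funext fun k => ?_) (funext fun j => Oct.ext ?_ (funext fun k => ?_)) <;>
  simp [tau, Alb.ofReal, Oct.ofReal, Cx.ofReal]

/-- The maps on `𝔍^C` extend those on `𝔍`. -/
theorem Alb.rowSign_ofReal (g : Fin 3 → ℝ) (X : Alb ℝ) :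
    Alb.rowSign (fun k => (g k : ℂ)) (Alb.ofReal X) = Alb.ofReal (Alb.rowSign g X) := by
  refine Prod.ext rfl (funext fun j => Oct.ext rfl (funext fun k => ?_))
  simp [Alb.rowSign, Alb.ofReal, Oct.ofReal, Cx.ofReal, QuadraticAlgebra.ext_iff]

theorem Alb.gamma1_ofReal (X : Alb ℝ) :
    Alb.gamma1 (Alb.ofReal X) = Alb.ofReal (Alb.gamma1 X) := by
  refine Prod.ext rfl (funext fun j => Oct.ext ?_ (funext fun k => ?_)) <;>
  simp [Alb.gamma1, Alb.ofReal, Oct.ofReal, Cx.ofReal]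

theorem Oct.ofReal_add (x y : Oct ℝ) : Oct.ofReal (x + y) = Oct.ofReal x + Oct.ofReal y := by
  refine Oct.ext ?_ (funext fun k => ?_) <;>
  simp [Oct.ofReal, Cx.ofReal, QuadraticAlgebra.ext_iff]

theorem Oct.ofReal_smul (r : ℝ) (x : Oct ℝ) : Oct.ofReal (r • x) = (r : ℂ) • Oct.ofReal x := by
  refine Oct.ext ?_ (funext fun k => ?_) <;>
  simp [Oct.ofReal, Cx.ofReal, QuadraticAlgebra.ext_iff]

theorem Oct.ofReal_star (x : Oct ℝ) : Oct.ofReal (star x) = star (Oct.ofReal x) := by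
  refine Oct.ext ?_ (funext fun k => ?_) <;>
  simp [Oct.ofReal, Cx.ofReal, QuadraticAlgebra.ext_iff]

theorem Alb.colSign_ofReal (s : Fin 3 → ℝ) (X : Alb ℝ) :
    Alb.colSign (fun k => (s k : ℂ)) (Alb.ofReal X) = Alb.ofReal (Alb.colSign s X) :=
  Prod.ext rfl (funext fun j => (Oct.ofReal_smul (s j) (X.2 j)).symm)

theorem Oct.ofReal_one : Oct.ofReal 1 = 1 := by
  refine Oct.ext ?_ (funext fun k => ?_) <;>
  simp [Oct.ofReal, Cx.ofReal, QuadraticAlgebra.ext_iff, QuadraticAlgebra.re_one,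
    QuadraticAlgebra.im_one]

theorem Oct.ofReal_mul (x y : Oct ℝ) : Oct.ofReal (x * y) = Oct.ofReal x * Oct.ofReal y := by
  refine Oct.ext ?_ (funext fun k => ?_)
  · simp [Oct.ofReal, Cx.ofReal, QuadraticAlgebra.ext_iff, Oct.mul_def, dotProduct,
      Fin.sum_univ_three]
  · fin_cases k <;>
    simp [Oct.ofReal, Cx.ofReal, QuadraticAlgebra.ext_iff, Oct.mul_def, cross_apply]

theorem Alb.toMatrix_ofReal (X : Alb ℝ) :
    Alb.toMatrix (Alb.ofReal X) = (Alb.toMatrix X).map Oct.ofReal := by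
  ext1 i j
  fin_cases i <;> fin_cases j <;>
  simp [Alb.toMatrix, Alb.ofReal, Oct.ofReal_star, Oct.ofReal_smul, Oct.ofReal_one]

theorem Alb.ofMatrix_map (A : Matrix (Fin 3) (Fin 3) (Oct ℝ)) :
    Alb.ofMatrix (A.map Oct.ofReal) = Alb.ofReal (Alb.ofMatrix A) := by
  refine Prod.ext rfl (funext fun k => ?_)
  fin_cases k <;> simp [Alb.ofMatrix, Alb.ofReal]

theorem Alb.jordan_ofReal (X Y : Alb ℝ) :
    Alb.jordan (Alb.ofReal X) (Alb.ofReal Y) = Alb.ofReal (Alb.jordan X Y) := by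
  rw [Alb.jordan, Alb.jordan, ← Alb.ofMatrix_map, Alb.toMatrix_ofReal, Alb.toMatrix_ofReal]
  congr 1
  ext1 i j
  simp [Matrix.mul_apply, Fin.sum_univ_three, Oct.ofReal_smul, Oct.ofReal_add, Oct.ofReal_mul]

/-- The Freudenthal product of `𝔍^C` extends that of `𝔍`. -/
theorem Alb.freudenthal_ofReal (X Y : Alb ℝ) :
    Alb.freudenthal (Alb.ofReal X) (Alb.ofReal Y) = Alb.ofReal (Alb.freudenthal X Y) := by
  simp only [Alb.freudenthal, Alb.form, Alb.tr, Alb.jordan_ofReal]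
  refine Prod.ext (funext fun k => ?_) (funext fun j => Oct.ext ?_ (funext fun k => ?_)) <;>
  simp [Alb.ofReal, Oct.ofReal, Cx.ofReal, Alb.unitE, QuadraticAlgebra.ext_iff]

/-- The Hermitian inner product `⟨X, Y⟩ = (τ X, Y)`. -/
def herm (X Y : JC) : ℂ := Alb.form (tau X) Y

/-- The group `Iso_C(𝔍^C)` of `ℂ`-linear automorphisms of `𝔍^C`, with its usual topology. -/
abbrev GLJC := (JC →L[ℂ] JC)ˣ

/-- The compact group `E₆` of all `α ∈ Iso_C(𝔍^C)` with `α X × α Y = τ α τ (X × Y)` and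
`⟨α X, α Y⟩ = ⟨X, Y⟩`. -/
def E6 : Subgroup GLJC where
  carrier := {α | ∀ X Y : JC,
    Alb.freudenthal (α.val X) (α.val Y) = tau (α.val (tau (Alb.freudenthal X Y))) ∧
    herm (α.val X) (α.val Y) = herm X Y}
  mul_mem' {α β} hα hβ X Y := by
    refine ⟨?_, ?_⟩
    · simp [(hα _ _).1, (hβ X Y).1]
    · simp [(hα _ _).2, (hβ X Y).2]
  one_mem' X Y := by simp
  inv_mem' {α} hα X Y := by
    have key : ∀ Z : JC, α.val (α⁻¹.val Z) = Z := fun Z => by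
      rw [← mul_apply_eq_comp, Units.mul_inv]; rfl
    have key' : ∀ Z : JC, α⁻¹.val (α.val Z) = Z := fun Z => by
      rw [← mul_apply_eq_comp, Units.inv_mul]; rfl
    have h := hα (α⁻¹.val X) (α⁻¹.val Y)
    rw [key, key] at h
    refine ⟨?_, h.2.symm⟩
    rw [h.1, tau_tau, key', tau_tau]

/-- An involutive linear map as an element of `Iso_C(𝔍^C)`. -/
def involUnit (f : JC →ₗ[ℂ] JC) (hf : ∀ X, f (f X) = X) : GLJC where
  val := LinearMap.toContinuousLinearMap f
  inv := LinearMap.toContinuousLinearMap f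
  val_inv := ContinuousLinearMap.ext hf
  inv_val := ContinuousLinearMap.ext hf

/-- `γ` on `𝔍^C`. -/
def gammaC : GLJC := involUnit Alb.gamma
  (Alb.rowSign_involutive (by intro k; fin_cases k <;> simp))

/-- `γ'` on `𝔍^C`. -/
def gammaC' : GLJC := involUnit Alb.gamma'
  (Alb.rowSign_involutive (by intro k; fin_cases k <;> simp))

/-- `σ` on `𝔍^C`. -/
def sigmaC : GLJC := involUnit Alb.sigma
  (Alb.colSign_involutive (by intro k; fin_cases k <;> simp))

/-- `σ'` on `𝔍^C`. -/
def sigmaC' : GLJC := involUnit Alb.sigma'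
  (Alb.colSign_involutive (by intro k; fin_cases k <;> simp))

/-- `γ₁` on `𝔍^C`. -/
def gamma1C : GLJC := involUnit Alb.gamma1 Alb.gamma1_involutive

/-- The subgroup `(E₆)^{γ, γ', σ, σ'}` of the elements of `E₆` that commute with
`γ`, `γ'`, `σ` and `σ'`. -/
def fixE6 : Subgroup E6 :=
  (Subgroup.centralizer {gammaC, gammaC', sigmaC, sigmaC'}).subgroupOf E6

/-! ### Tori and the semidirect product -/

/-- A subgroup of a topological group is a torus if it is isomorphic, as a topological group,
to `U(1)ⁿ` for some `n`. -/
def IsTorus {G : Type*} [Group G] [TopologicalSpace G] (H : Subgroup G) : Prop :=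
  ∃ n : ℕ, Nonempty (H ≃ₜ* (Fin n → Circle))

/-- A maximal torus: a torus that is contained in no larger torus. -/
def IsMaximalTorus {G : Type*} [Group G] [TopologicalSpace G] (H : Subgroup G) : Prop :=
  Maximal IsTorus H

/-- The group `U(1)^{×6}`. -/
abbrev T6 := Fin 6 → Circle

/-- The automorphism
`(p, q, a₁, a₂, a₃, a₄) ↦ (p̄, q̄, ā₃, ā₄, ā₁, ā₂)` of `U(1)^{×6}` (on `U(1)`, `z̄ = z⁻¹`). -/
def theta : MulAut T6 where
  toFun z := ![(z 0)⁻¹, (z 1)⁻¹, (z 4)⁻¹, (z 5)⁻¹, (z 2)⁻¹, (z 3)⁻¹]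
  invFun z := ![(z 0)⁻¹, (z 1)⁻¹, (z 4)⁻¹, (z 5)⁻¹, (z 2)⁻¹, (z 3)⁻¹]
  left_inv z := by funext k; fin_cases k <;> simp
  right_inv z := by funext k; fin_cases k <;> simp
  map_mul' z w := by funext k; fin_cases k <;> simp [mul_comm]

theorem theta_mul_self : theta * theta = 1 :=
  MulEquiv.ext fun z => theta.left_inv z

/-- The action of `ℤ₂` on `U(1)^{×6}` whose nontrivial element acts by `theta`. -/
def thetaHom : Multiplicative (ZMod 2) →* MulAut T6 where
  toFun s := if s = 1 then 1 else theta
  map_one' := by simp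
  map_mul' s t := by
    have h : ∀ s : Multiplicative (ZMod 2), s = 1 ∨ s = Multiplicative.ofAdd 1 := by decide
    have h1 : (Multiplicative.ofAdd 1 : Multiplicative (ZMod 2)) ≠ 1 := by decide
    have h2 : (Multiplicative.ofAdd 1 * Multiplicative.ofAdd 1 : Multiplicative (ZMod 2)) = 1 := by
      decide
    rcases h s with rfl | rfl <;> rcases h t with rfl | rfl <;> simp [h1, h2, theta_mul_self]

end ExcE6

end

/-! A weight-space argument in the 27-dimensional representation.

Over `ℂ` the algebra `ℂ[e₁]` splits as `ℂ × ℂ` (`Cx.plus`, `Cx.minus`), and so `𝔍^C` has 27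
coordinates `ξ_j`, `a_j^±`, `m_{kj}^±`. In these, the Hermitian form is the standard one, and the
Freudenthal product is dual to a cubic form all of whose monomials are products of three distinct
coordinates. A diagonal unitary map therefore lies in `E₆` if and only if its eigenvalues have
product `1` along each monomial. These equations have exactly a 6-dimensional torus of solutions,
parametrized by `torus`; its six coordinates are chosen so that conjugation by `γ₁`, which swaps
`+` and `-`, becomes `theta` (`gamma1C_mul_torus`). The four involutions are torus elements.

Conversely, let `α ∈ E₆` commute with the involutions. Their joint eigenspaces are the diagonal and
the twelve planes of the `a_j` and the `m_{kj}`, hence `α` preserves each of these planes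
(`CommInvol.exists_scE`, `CommInvol.exists_vecE`). In the plane of `a₁`, the condition `X × X = 0`
singles out the two weight lines, so `α` fixes or swaps them; composing with `γ₁` one may assume
that it fixes them. Vanishing products of weight vectors then force `α` to be diagonal on the
weight vectors of `a₁`, `a₂`, `m₁₁⁺` and `m₂₁⁺`, with eigenvalues of modulus one. Some torus element
has the same six eigenvalues. Since an element of `E₆` is conjugate-linearly compatible with `×`,
the set on which two of them agree is closed under `(X, Y) ↦ τ(X × Y)`, and the six weight vectors
generate `𝔍^C` under this operation (`eq_top_of_generators`); so `α` is that torus element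
(`exists_torus_of_minus_eq_zero`).

Thus `T⁶ × ℤ₂` maps onto the fixed-point group by a continuous bijection from a compact to a
Hausdorff space, a homeomorphism. The identity component is the image of the torus. It is a maximal
torus because it contains the involutions: a torus containing it is commutative, hence consists of
elements commuting with the involutions, and is connected, hence lies in the identity component. -/

noncomputable section

namespace ExcE6

open Complex

/-! ### The splitting `ℂ[e₁] ≅ ℂ × ℂ` -/

namespace Cx

/-- The homomorphism `ℂ[e₁] → ℂ` with `e₁ ↦ i`. -/
def plus : Cx ℂ →+* ℂ where
  toFun z := z.re + I * z.im
  map_one' := by simp [QuadraticAlgebra.re_one, QuadraticAlgebra.im_one]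
  map_zero' := by simp
  map_add' z w := by simp; ring
  map_mul' z w := by simp; linear_combination (- z.im * w.im) * I_mul_I

/-- The homomorphism `ℂ[e₁] → ℂ` with `e₁ ↦ -i`. -/
def minus : Cx ℂ →+* ℂ where
  toFun z := z.re - I * z.im
  map_one' := by simp [QuadraticAlgebra.re_one, QuadraticAlgebra.im_one]
  map_zero' := by simp
  map_add' z w := by simp; ring
  map_mul' z w := by simp; linear_combination (- z.im * w.im) * I_mul_I

/-- The element of `ℂ[e₁]` with prescribed images under `e₁ ↦ i` and `e₁ ↦ -i`. -/
def ofPair (u v : ℂ) : Cx ℂ := ⟨(u + v) / 2, I * ((v - u) / 2)⟩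

theorem plus_apply (z : Cx ℂ) : plus z = z.re + I * z.im := rfl

theorem minus_apply (z : Cx ℂ) : minus z = z.re - I * z.im := rfl

theorem re_eq (z : Cx ℂ) : z.re = (plus z + minus z) / 2 := by
  rw [plus_apply, minus_apply]; ring

theorem im_eq (z : Cx ℂ) : z.im = I * ((minus z - plus z) / 2) := by
  rw [plus_apply, minus_apply]; linear_combination z.im * I_mul_I

theorem ext_pair {z w : Cx ℂ} (h : plus z = plus w) (h' : minus z = minus w) : z = w := by
  refine QuadraticAlgebra.ext ?_ ?_
  · rw [re_eq, re_eq, h, h']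
  · rw [im_eq, im_eq, h, h']

@[simp] theorem plus_ofPair (u v : ℂ) : plus (ofPair u v) = u := by
  simp only [plus_apply, ofPair]; linear_combination ((v - u) / 2) * I_mul_I

@[simp] theorem minus_ofPair (u v : ℂ) : minus (ofPair u v) = v := by
  simp only [minus_apply, ofPair]; linear_combination (-(v - u) / 2) * I_mul_I

@[simp] theorem plus_star (z : Cx ℂ) : plus (star z) = minus z := by
  simp [plus_apply, minus_apply]; ring

@[simp] theorem minus_star (z : Cx ℂ) : minus (star z) = plus z := by
  simp [plus_apply, minus_apply]

@[simp] theorem plus_smul (r : ℂ) (z : Cx ℂ) : plus (r • z) = r * plus z := by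
  simp [plus_apply]; ring

@[simp] theorem minus_smul (r : ℂ) (z : Cx ℂ) : minus (r • z) = r * minus z := by
  simp [minus_apply]; ring

/-- The complex conjugation of `ℂ[e₁]` that fixes `e₁`. -/
def conj (z : Cx ℂ) : Cx ℂ := ⟨star z.re, star z.im⟩

@[simp] theorem plus_conj (z : Cx ℂ) : plus (conj z) = star (minus z) := by
  simp [plus_apply, minus_apply, conj]

@[simp] theorem minus_conj (z : Cx ℂ) : minus (conj z) = star (plus z) := by
  simp [plus_apply, minus_apply, conj]; ring

theorem ofPair_one : ofPair 1 1 = 1 := ext_pair (by simp) (by simp)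

end Cx

open Cx

@[simp] theorem tau_fst (X : JC) (j : Fin 3) : (tau X).1 j = star (X.1 j) := rfl

@[simp] theorem tau_sc (X : JC) (j : Fin 3) : ((tau X).2 j).sc = conj (X.2 j).sc := rfl

@[simp] theorem tau_vec (X : JC) (j k : Fin 3) :
    ((tau X).2 j).vec k = conj ((X.2 j).vec k) := rfl

theorem tau_smul (r : ℂ) (X : JC) : tau (r • X) = star r • tau X := by
  refine Prod.ext (funext fun j => ?_) (funext fun j => Oct.ext ?_ (funext fun k => ?_))
  · simp
  · refine ext_pair ?_ ?_ <;> simp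
  · refine ext_pair ?_ ?_ <;> simp

/-- Two elements of `𝔍^C` agree if their 27 coordinates do. -/
theorem ext_coord {X Y : JC} (h₁ : ∀ j, X.1 j = Y.1 j)
    (h₂ : ∀ j, plus (X.2 j).sc = plus (Y.2 j).sc)
    (h₃ : ∀ j, minus (X.2 j).sc = minus (Y.2 j).sc)
    (h₄ : ∀ j k, plus ((X.2 j).vec k) = plus ((Y.2 j).vec k))
    (h₅ : ∀ j k, minus ((X.2 j).vec k) = minus ((Y.2 j).vec k)) : X = Y :=
  Prod.ext (funext h₁) (funext fun j => Oct.ext (ext_pair (h₂ j) (h₃ j))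
    (funext fun k => ext_pair (h₄ j k) (h₅ j k)))

/-! ### The products in coordinates -/

theorem re_sc_mul (x y : Oct ℂ) : (x * y).sc.re =
    1 / 2 * (plus x.sc * plus y.sc + minus x.sc * minus y.sc -
      ∑ k, (plus (x.vec k) * minus (y.vec k) + minus (x.vec k) * plus (y.vec k))) := by
  simp only [re_eq, Oct.mul_def, dotProduct, Fin.sum_univ_three, map_sub, map_mul, map_add,
    Pi.star_apply, plus_star, minus_star]
  ring

theorem smul_one_mul' (r : ℂ) (x : Oct ℂ) : (r • (1 : Oct ℂ)) * x = r • x := by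
  refine Oct.ext ?_ ?_ <;> simp [Oct.mul_def]

theorem mul_smul_one' (r : ℂ) (x : Oct ℂ) : x * (r • (1 : Oct ℂ)) = r • x := by
  refine Oct.ext ?_ ?_
  · simp [Oct.mul_def]
  · funext k; refine QuadraticAlgebra.ext ?_ ?_ <;>
      simp [Oct.mul_def, QuadraticAlgebra.re_one, QuadraticAlgebra.im_one]

theorem jordan_fst (X Y : JC) (j : Fin 3) : (Alb.jordan X Y).1 j = X.1 j * Y.1 j +
    1 / 2 * ((X.2 (j + 1) * star (Y.2 (j + 1))).sc.re + (Y.2 (j + 1) * star (X.2 (j + 1))).sc.re +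
      (X.2 (j + 2) * star (Y.2 (j + 2))).sc.re + (Y.2 (j + 2) * star (X.2 (j + 2))).sc.re) := by
  have h : ∀ x y : Oct ℂ, (star x * y).sc.re = (y * star x).sc.re := fun x y => by
    simp only [re_sc_mul, Oct.star_sc, Oct.star_vec, Fin.sum_univ_three, Pi.neg_apply, map_neg]
    ring
  fin_cases j <;>
  · simp only [Alb.jordan, Alb.ofMatrix, Matrix.smul_apply, Matrix.add_apply, Matrix.mul_apply,
      Fin.sum_univ_three, Alb.toMatrix]
    simp [smul_one_mul', h, QuadraticAlgebra.re_one]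
    ring

theorem jordan_snd (X Y : JC) (j : Fin 3) : (Alb.jordan X Y).2 j =
    (1 / 2 : ℂ) • (star (X.2 (j + 1) * Y.2 (j + 2) + Y.2 (j + 1) * X.2 (j + 2)) +
      (X.1 (j + 1) + X.1 (j + 2)) • Y.2 j + (Y.1 (j + 1) + Y.1 (j + 2)) • X.2 j) := by
  fin_cases j <;>
  · simp only [Alb.jordan, Alb.ofMatrix, Matrix.smul_apply, Matrix.add_apply, Matrix.mul_apply,
      Fin.sum_univ_three, Alb.toMatrix]
    simp [smul_one_mul', mul_smul_one', Oct.star_add', Oct.star_mul']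
    module

theorem form_eq (X Y : JC) : Alb.form X Y = ∑ j, (X.1 j * Y.1 j +
    (plus (X.2 j).sc * minus (Y.2 j).sc + minus (X.2 j).sc * plus (Y.2 j).sc +
     ∑ k, (plus ((X.2 j).vec k) * minus ((Y.2 j).vec k)
      + minus ((X.2 j).vec k) * plus ((Y.2 j).vec k)))) := by
  simp only [Alb.form, Alb.tr, jordan_fst, Fin.sum_univ_three, re_sc_mul, Oct.star_sc,
    Oct.star_vec, Pi.neg_apply, map_neg, plus_star, minus_star, Fin.isValue, Fin.reduceAdd]
  ring

theorem freudenthal_fst (X Y : JC) (j : Fin 3) : (Alb.freudenthal X Y).1 j =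
    1 / 2 * (X.1 (j + 1) * Y.1 (j + 2) + X.1 (j + 2) * Y.1 (j + 1) -
    (plus (X.2 j).sc * minus (Y.2 j).sc + minus (X.2 j).sc * plus (Y.2 j).sc +
     ∑ k, (plus ((X.2 j).vec k) * minus ((Y.2 j).vec k)
      + minus ((X.2 j).vec k) * plus ((Y.2 j).vec k)))) := by
  simp only [Alb.freudenthal, Prod.smul_fst, Prod.fst_sub, Prod.fst_add, Pi.smul_apply,
    Pi.sub_apply, Pi.add_apply, smul_eq_mul, jordan_fst, form_eq, Alb.tr, Alb.unitE,
    re_sc_mul, Oct.star_sc, Oct.star_vec, Pi.neg_apply, map_neg, plus_star, minus_star]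
  fin_cases j <;>
  · simp only [Fin.sum_univ_three, Fin.isValue, Fin.reduceAdd, Fin.zero_eta, Fin.mk_one,
      Fin.reduceFinMk, Pi.one_apply]
    ring

/-- Off the diagonal the Freudenthal product is cyclically symmetric in the indices, which are
taken modulo 3. -/
theorem freudenthal_snd (X Y : JC) (j : Fin 3) : (Alb.freudenthal X Y).2 j =
    (1 / 2 : ℂ) • (star (X.2 (j + 1) * Y.2 (j + 2) + Y.2 (j + 1) * X.2 (j + 2))
      - X.1 j • Y.2 j - Y.1 j • X.2 j) := by
  have h : ∀ f : Fin 3 → ℂ, ∑ i, f i = f j + f (j + 1) + f (j + 2) := fun f => by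
    fin_cases j <;> simp [Fin.sum_univ_three] <;> ring
  simp only [Alb.freudenthal, Prod.smul_snd, Prod.snd_sub, Prod.snd_add, Pi.smul_apply,
    Pi.sub_apply, Pi.add_apply, jordan_snd, Alb.tr, Alb.unitE, h, Pi.zero_apply, smul_zero]
  module

/-- In the coordinates `ξ_j`, `a_j^±`, `m_{kj}^±` the Hermitian form is the standard one. -/
theorem herm_eq (X Y : JC) : herm X Y = ∑ j, (star (X.1 j) * Y.1 j +
    (star (minus (X.2 j).sc) * minus (Y.2 j).sc + star (plus (X.2 j).sc) * plus (Y.2 j).sc +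
     ∑ k, (star (minus ((X.2 j).vec k)) * minus ((Y.2 j).vec k)
      + star (plus ((X.2 j).vec k)) * plus ((Y.2 j).vec k)))) := by
  simp only [herm, form_eq, tau_fst, tau_sc, tau_vec, plus_conj, minus_conj]

/-! ### The torus -/

/-- The linear map of `𝔍^C` that scales the coordinates `ξ_j`, `a_j` and `m_{kj}`. -/
def diagMap (w : (Fin 3 → ℂ) × (Fin 3 → Cx ℂ) × (Fin 3 → Fin 3 → Cx ℂ)) : JC →ₗ[ℂ] JC where
  toFun X := (w.1 * X.1, fun j => ⟨w.2.1 j * (X.2 j).sc, w.2.2 j * (X.2 j).vec⟩)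
  map_add' X Y := by
    refine Prod.ext (mul_add _ _ _) (funext fun j => Oct.ext (mul_add _ _ _) (mul_add _ _ _))
  map_smul' r X := by
    refine Prod.ext (mul_smul_comm _ _ _) (funext fun j => Oct.ext ?_ ?_)
    · exact mul_smul_comm r (w.2.1 j) (X.2 j).sc
    · exact mul_smul_comm r (w.2.2 j) (X.2 j).vec

/-- The eigenvalues of the torus element `t = (p, q, a₁, a₂, a₃, a₄)` on the coordinates `ξ_j`,
on `a_j` and on `m_{kj}`, the last ones being `(weight t).2.2 j k`. Scaling `a_j^+` and `a_j^-` by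
`u` and `v` is multiplication by `ofPair u v`. Here `a₁, a₂` are the eigenvalues on the coordinates
`a_1^+, a_2^+`, and `a₃, a₄` the inverses of those on `a_1^-, a_2^-`. The eigenvalue on `m_{k1}^+`
is `r k * a₁` with `r = (p, q, r₃)`; the cubic monomials `a_i^± m_{kj}^± m_{kl}^∓` then determine
the other columns, and `m_{11}^+ m_{22}^+ m_{33}^+` determines `r₃`. -/
def weight (t : T6) : (Fin 3 → ℂ) × (Fin 3 → Cx ℂ) × (Fin 3 → Fin 3 → Cx ℂ) :=
  let c : Circle → Circle → Cx ℂ := fun u v => ofPair u v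
  let r : Fin 3 → Circle := ![t 0, t 1, (t 3 * t 5) / (t 2 * t 4 * t 0 * t 1)]
  (fun j => ((![t 4 / t 2, t 5 / t 3, t 2 * t 3 / (t 4 * t 5)] j : Circle) : ℂ),
   ![c (t 2) (t 4)⁻¹, c (t 3) (t 5)⁻¹, c (t 2 * t 3)⁻¹ (t 4 * t 5)],
   ![fun k => c (r k * t 2) (r k * t 4)⁻¹, fun k => c (r k / t 5) (t 3 / r k),
     fun k => c (r k * t 4 / t 3) (t 5 / (r k * t 2))])

theorem weight_one : weight 1 = 1 := by
  refine Prod.ext ?_ (Prod.ext ?_ ?_)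
  · funext j; fin_cases j <;> simp [weight]
  · funext j; fin_cases j <;> simp [weight, ofPair_one]
  · funext j k; fin_cases j <;> fin_cases k <;> simp [weight, ofPair_one]

set_option maxHeartbeats 1000000 in
theorem weight_mul (t t' : T6) : weight (t * t') = weight t * weight t' := by
  refine Prod.ext ?_ (Prod.ext ?_ ?_)
  · funext j; fin_cases j <;> simp [weight] <;> field_simp
  · funext j; fin_cases j <;> refine ext_pair ?_ ?_ <;> simp [weight] <;> field_simp
  · funext j k; fin_cases j <;> fin_cases k <;> refine ext_pair ?_ ?_ <;>
      simp only [weight, Fin.zero_eta, Fin.mk_one, Fin.reduceFinMk, Fin.isValue, Matrix.cons_val,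
        plus_ofPair, minus_ofPair, map_mul, Prod.snd_mul, Pi.mul_apply] <;>
      simp <;> field_simp

/-- The homomorphism from `U(1)^{×6}` to the diagonal maps of `𝔍^C`. -/
def torus : T6 →* GLJC := MonoidHom.toHomUnits
  { toFun := fun t => LinearMap.toContinuousLinearMap (diagMap (weight t))
    map_one' := by
      refine ContinuousLinearMap.ext fun X => ?_
      refine Prod.ext ?_ (funext fun j => Oct.ext ?_ ?_) <;> simp [diagMap, weight_one]
    map_mul' := fun t t' => by
      refine ContinuousLinearMap.ext fun X => ?_
      refine Prod.ext ?_ (funext fun j => Oct.ext ?_ ?_) <;>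
      simp [diagMap, weight_mul, mul_assoc] }

theorem torus_fst (t : T6) (X : JC) (j : Fin 3) :
    ((torus t).val X).1 j = (weight t).1 j * X.1 j := rfl

theorem torus_sc (t : T6) (X : JC) (j : Fin 3) :
    (((torus t).val X).2 j).sc = (weight t).2.1 j * (X.2 j).sc := rfl

theorem torus_vec (t : T6) (X : JC) (j k : Fin 3) :
    (((torus t).val X).2 j).vec k = (weight t).2.2 j k * (X.2 j).vec k := rfl

theorem circle_star (z : Circle) : (starRingEnd ℂ) (z : ℂ) = (z : ℂ)⁻¹ := by
  rw [← Circle.coe_inv, Circle.coe_inv_eq_conj]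

theorem plus_freudenthal_sc (X Y : JC) (j : Fin 3) : plus ((Alb.freudenthal X Y).2 j).sc =
    1 / 2 * (minus (X.2 (j + 1)).sc * minus (Y.2 (j + 2)).sc
      + minus (Y.2 (j + 1)).sc * minus (X.2 (j + 2)).sc
      - ∑ k, (minus ((X.2 (j + 1)).vec k) * plus ((Y.2 (j + 2)).vec k)
        + minus ((Y.2 (j + 1)).vec k) * plus ((X.2 (j + 2)).vec k))
      - X.1 j * plus (Y.2 j).sc - Y.1 j * plus (X.2 j).sc) := by
  simp only [freudenthal_snd, Oct.mul_def, Oct.smul_sc, Oct.sub_sc, Oct.add_sc, Oct.star_sc,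
    dotProduct, Fin.sum_univ_three, map_sub, map_add, map_mul, plus_smul, plus_star, minus_star,
    Pi.star_apply]
  ring

theorem minus_freudenthal_sc (X Y : JC) (j : Fin 3) : minus ((Alb.freudenthal X Y).2 j).sc =
    1 / 2 * (plus (X.2 (j + 1)).sc * plus (Y.2 (j + 2)).sc
      + plus (Y.2 (j + 1)).sc * plus (X.2 (j + 2)).sc
      - ∑ k, (plus ((X.2 (j + 1)).vec k) * minus ((Y.2 (j + 2)).vec k)
        + plus ((Y.2 (j + 1)).vec k) * minus ((X.2 (j + 2)).vec k))
      - X.1 j * minus (Y.2 j).sc - Y.1 j * minus (X.2 j).sc) := by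
  simp only [freudenthal_snd, Oct.mul_def, Oct.smul_sc, Oct.sub_sc, Oct.add_sc, Oct.star_sc,
    dotProduct, Fin.sum_univ_three, map_sub, map_add, map_mul, minus_smul, plus_star, minus_star,
    Pi.star_apply]
  ring

theorem cross_apply_cyclic (m n : Fin 3 → Cx ℂ) (k : Fin 3) :
    (m ⨯₃ n) k = m (k + 1) * n (k + 2) - m (k + 2) * n (k + 1) := by
  fin_cases k <;> rfl

theorem plus_freudenthal_vec (X Y : JC) (j k : Fin 3) :
    plus (((Alb.freudenthal X Y).2 j).vec k) =
    -1 / 2 * (plus (X.2 (j + 1)).sc * plus ((Y.2 (j + 2)).vec k)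
      + plus (Y.2 (j + 1)).sc * plus ((X.2 (j + 2)).vec k)
      + minus (Y.2 (j + 2)).sc * plus ((X.2 (j + 1)).vec k)
      + minus (X.2 (j + 2)).sc * plus ((Y.2 (j + 1)).vec k)
      + minus ((X.2 (j + 1)).vec (k + 1)) * minus ((Y.2 (j + 2)).vec (k + 2))
      - minus ((X.2 (j + 1)).vec (k + 2)) * minus ((Y.2 (j + 2)).vec (k + 1))
      + minus ((Y.2 (j + 1)).vec (k + 1)) * minus ((X.2 (j + 2)).vec (k + 2))
      - minus ((Y.2 (j + 1)).vec (k + 2)) * minus ((X.2 (j + 2)).vec (k + 1))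
      + X.1 j * plus ((Y.2 j).vec k) + Y.1 j * plus ((X.2 j).vec k)) := by
  simp only [freudenthal_snd, Oct.mul_def, Oct.smul_vec, Oct.sub_vec, Oct.add_vec, Oct.star_vec,
    Pi.smul_apply, Pi.sub_apply, Pi.add_apply, Pi.neg_apply, cross_apply_cyclic, smul_eq_mul,
    map_sub, map_add, map_mul, map_neg, plus_smul, plus_star, Pi.star_apply]
  ring

theorem minus_freudenthal_vec (X Y : JC) (j k : Fin 3) :
    minus (((Alb.freudenthal X Y).2 j).vec k) =
    -1 / 2 * (minus (X.2 (j + 1)).sc * minus ((Y.2 (j + 2)).vec k)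
      + minus (Y.2 (j + 1)).sc * minus ((X.2 (j + 2)).vec k)
      + plus (Y.2 (j + 2)).sc * minus ((X.2 (j + 1)).vec k)
      + plus (X.2 (j + 2)).sc * minus ((Y.2 (j + 1)).vec k)
      + plus ((X.2 (j + 1)).vec (k + 1)) * plus ((Y.2 (j + 2)).vec (k + 2))
      - plus ((X.2 (j + 1)).vec (k + 2)) * plus ((Y.2 (j + 2)).vec (k + 1))
      + plus ((Y.2 (j + 1)).vec (k + 1)) * plus ((X.2 (j + 2)).vec (k + 2))
      - plus ((Y.2 (j + 1)).vec (k + 2)) * plus ((X.2 (j + 2)).vec (k + 1))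
      + X.1 j * minus ((Y.2 j).vec k) + Y.1 j * minus ((X.2 j).vec k)) := by
  simp only [freudenthal_snd, Oct.mul_def, Oct.smul_vec, Oct.sub_vec, Oct.add_vec, Oct.star_vec,
    Pi.smul_apply, Pi.sub_apply, Pi.add_apply, Pi.neg_apply, cross_apply_cyclic, smul_eq_mul,
    map_sub, map_add, map_mul, map_neg, minus_smul, minus_star, Pi.star_apply]
  ring

set_option maxHeartbeats 2000000 in
/-- Along each monomial of the cubic form the eigenvalues of `torus t` have product `1`. -/
theorem freudenthal_torus (t : T6) (X Y : JC) :
    Alb.freudenthal ((torus t).val X) ((torus t).val Y) =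
      tau ((torus t).val (tau (Alb.freudenthal X Y))) := by
  refine ext_coord (fun j => ?_) (fun j => ?_) (fun j => ?_) (fun j k => ?_) (fun j k => ?_) <;>
    simp only [torus_fst, torus_sc, torus_vec, freudenthal_fst, plus_freudenthal_sc,
      minus_freudenthal_sc, plus_freudenthal_vec, minus_freudenthal_vec, Fin.sum_univ_three,
      tau_fst, tau_sc, tau_vec, plus_conj, minus_conj, map_mul, star_mul', star_star]
  · fin_cases j <;>
      simp only [weight, Fin.zero_eta, Fin.mk_one, Fin.reduceFinMk, Fin.reduceAdd,
        Fin.isValue, Matrix.cons_val, plus_ofPair, minus_ofPair] <;>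
      simp [circle_star] <;> field_simp
  · fin_cases j <;>
      simp only [weight, Fin.zero_eta, Fin.mk_one, Fin.reduceFinMk, Fin.reduceAdd,
        Fin.isValue, Matrix.cons_val, plus_ofPair, minus_ofPair] <;>
      simp [circle_star] <;> field_simp
  · fin_cases j <;>
      simp only [weight, Fin.zero_eta, Fin.mk_one, Fin.reduceFinMk, Fin.reduceAdd,
        Fin.isValue, Matrix.cons_val, plus_ofPair, minus_ofPair] <;>
      simp [circle_star] <;> field_simp
  · fin_cases j <;> fin_cases k <;>
      simp only [weight, Fin.zero_eta, Fin.mk_one, Fin.reduceFinMk, Fin.reduceAdd,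
        Fin.isValue, Matrix.cons_val, plus_ofPair, minus_ofPair] <;>
      simp [circle_star] <;> field_simp
  · fin_cases j <;> fin_cases k <;>
      simp only [weight, Fin.zero_eta, Fin.mk_one, Fin.reduceFinMk, Fin.reduceAdd,
        Fin.isValue, Matrix.cons_val, plus_ofPair, minus_ofPair] <;>
      simp [circle_star] <;> field_simp

theorem weight_fst_mem (t : T6) (j : Fin 3) : ∃ c : Circle, (weight t).1 j = c := ⟨_, rfl⟩

theorem weight_sc_mem (t : T6) (j : Fin 3) : ∃ c d : Circle, (weight t).2.1 j = ofPair c d := by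
  fin_cases j <;> exact ⟨_, _, rfl⟩

theorem weight_vec_mem (t : T6) (j k : Fin 3) :
    ∃ c d : Circle, (weight t).2.2 j k = ofPair c d := by
  fin_cases j <;> exact ⟨_, _, rfl⟩

/-- Scaling by a complex number of modulus one preserves the standard Hermitian form. -/
theorem circle_star_mul (c : Circle) (x y : ℂ) :
    star ((c : ℂ) * x) * ((c : ℂ) * y) = star x * y := by
  have h : star (c : ℂ) * c = 1 := by
    rw [Complex.star_def, circle_star]; exact inv_mul_cancel₀ c.coe_ne_zero
  rw [star_mul']
  linear_combination (star x * y) * h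

theorem herm_torus (t : T6) (X Y : JC) :
    herm ((torus t).val X) ((torus t).val Y) = herm X Y := by
  rw [herm_eq, herm_eq]
  refine Finset.sum_congr rfl fun j _ => ?_
  obtain ⟨c, hc⟩ := weight_fst_mem t j
  obtain ⟨u, v, hu⟩ := weight_sc_mem t j
  rw [torus_fst, torus_fst, torus_sc, torus_sc, hc, hu]
  simp only [map_mul, plus_ofPair, minus_ofPair, circle_star_mul]
  congr 2
  refine Finset.sum_congr rfl fun k _ => ?_
  obtain ⟨u, v, hu⟩ := weight_vec_mem t j k
  simp only [torus_vec, hu, map_mul, plus_ofPair, minus_ofPair, circle_star_mul]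

theorem torus_mem (t : T6) : torus t ∈ E6 :=
  fun X Y => ⟨freudenthal_torus t X Y, herm_torus t X Y⟩

/-! ### The involutions -/

theorem gamma1C_fst (X : JC) (j : Fin 3) : (gamma1C.val X).1 j = X.1 j := rfl

theorem gamma1C_sc (X : JC) (j : Fin 3) :
    ((gamma1C.val X).2 j).sc = star (X.2 j).sc := rfl

theorem gamma1C_vec (X : JC) (j k : Fin 3) :
    ((gamma1C.val X).2 j).vec k = star ((X.2 j).vec k) := rfl

theorem gamma1C_mem : gamma1C ∈ E6 := by
  refine fun X Y => ⟨?_, ?_⟩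
  · refine ext_coord (fun j => ?_) (fun j => ?_) (fun j => ?_) (fun j k => ?_) (fun j k => ?_) <;>
      simp only [gamma1C_fst, gamma1C_sc, gamma1C_vec, freudenthal_fst, plus_freudenthal_sc,
        minus_freudenthal_sc, plus_freudenthal_vec, minus_freudenthal_vec, Fin.sum_univ_three,
        tau_fst, tau_sc, tau_vec, plus_conj, minus_conj, plus_star, minus_star, star_star] <;>
      ring
  · rw [herm_eq, herm_eq]
    simp only [gamma1C_fst, gamma1C_sc, gamma1C_vec, Fin.sum_univ_three, plus_star, minus_star]
    ring

theorem gamma1C_mul_self : gamma1C * gamma1C = 1 := Units.ext gamma1C.val_inv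

set_option maxHeartbeats 1000000 in
/-- Conjugation by `γ₁` acts on the torus by `theta`. -/
theorem gamma1C_mul_torus (t : T6) : gamma1C * torus t = torus (theta t) * gamma1C := by
  refine Units.ext (ContinuousLinearMap.ext fun X => ?_)
  change gamma1C.val ((torus t).val X) = (torus (theta t)).val (gamma1C.val X)
  refine ext_coord (fun j => ?_) (fun j => ?_) (fun j => ?_) (fun j k => ?_) (fun j k => ?_) <;>
    simp only [gamma1C_fst, gamma1C_sc, gamma1C_vec, torus_fst, torus_sc, torus_vec, star_mul',
      map_mul, plus_star, minus_star] <;> congr 1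
  · fin_cases j <;> simp [weight, theta] <;> field_simp
  · fin_cases j <;> simp [weight, theta, mul_comm]
  · fin_cases j <;> simp [weight, theta] <;> field_simp
  · fin_cases j <;> fin_cases k <;>
      simp only [weight, Fin.zero_eta, Fin.mk_one, Fin.reduceFinMk, Fin.isValue, Matrix.cons_val,
        plus_ofPair, minus_ofPair] <;>
      simp [theta] <;> field_simp
  · fin_cases j <;> fin_cases k <;>
      simp only [weight, Fin.zero_eta, Fin.mk_one, Fin.reduceFinMk, Fin.isValue, Matrix.cons_val,
        plus_ofPair, minus_ofPair] <;>
      simp [theta] <;> field_simp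

/-- `α` multiplies `a_j` by `s j` and `m_{kj}` by `g k * s j`, and fixes the diagonal. -/
def IsSignMap (α : GLJC) (s g : Fin 3 → ℂ) : Prop :=
  ∀ X : JC, α.val X =
    (X.1, fun j => ⟨s j • (X.2 j).sc, fun k => (g k * s j) • (X.2 j).vec k⟩)

theorem isSignMap_gammaC : IsSignMap gammaC 1 ![1, -1, -1] := fun X =>
  Prod.ext rfl (funext fun j => Oct.ext (one_smul _ _).symm (funext fun k => by
    dsimp only; rw [Pi.one_apply, mul_one]; rfl))

theorem isSignMap_gammaC' : IsSignMap gammaC' 1 ![-1, 1, -1] := fun X =>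
  Prod.ext rfl (funext fun j => Oct.ext (one_smul _ _).symm (funext fun k => by
    dsimp only; rw [Pi.one_apply, mul_one]; rfl))

theorem isSignMap_sigmaC : IsSignMap sigmaC ![1, -1, -1] 1 := fun X =>
  Prod.ext rfl (funext fun j => Oct.ext rfl (funext fun k => by
    dsimp only; rw [Pi.one_apply, one_mul]; rfl))

theorem isSignMap_sigmaC' : IsSignMap sigmaC' ![-1, -1, 1] 1 := fun X =>
  Prod.ext rfl (funext fun j => Oct.ext rfl (funext fun k => by
    dsimp only; rw [Pi.one_apply, one_mul]; rfl))

theorem IsSignMap.eq_torus {α : GLJC} {s g : Fin 3 → ℂ} (hα : IsSignMap α s g) {t : T6}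
    (h1 : ∀ j, (weight t).1 j = 1) (h2 : ∀ j, (weight t).2.1 j = ofPair (s j) (s j))
    (h3 : ∀ j k, (weight t).2.2 j k = ofPair (g k * s j) (g k * s j)) : α = torus t := by
  refine Units.ext (ContinuousLinearMap.ext fun X => ?_)
  refine (hα X).trans (ext_coord (fun j => ?_) (fun j => ?_) (fun j => ?_) (fun j k => ?_)
    (fun j k => ?_)) <;>
  simp [torus_fst, torus_sc, torus_vec, h1, h2, h3]

theorem gammaC_eq : gammaC = torus ![1, -1, 1, 1, 1, 1] := by
  refine isSignMap_gammaC.eq_torus (fun j => ?_) (fun j => ?_) (fun j k => ?_) <;>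
    fin_cases j <;> (try fin_cases k) <;> simp [weight, div_neg, inv_neg]

theorem gammaC'_eq : gammaC' = torus ![-1, 1, 1, 1, 1, 1] := by
  refine isSignMap_gammaC'.eq_torus (fun j => ?_) (fun j => ?_) (fun j k => ?_) <;>
    fin_cases j <;> (try fin_cases k) <;> simp [weight, div_neg, inv_neg]

theorem sigmaC_eq : sigmaC = torus ![1, 1, 1, -1, 1, -1] := by
  refine isSignMap_sigmaC.eq_torus (fun j => ?_) (fun j => ?_) (fun j k => ?_) <;>
    fin_cases j <;> (try fin_cases k) <;> simp [weight, div_neg, inv_neg]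

theorem sigmaC'_eq : sigmaC' = torus ![1, 1, -1, -1, -1, -1] := by
  refine isSignMap_sigmaC'.eq_torus (fun j => ?_) (fun j => ?_) (fun j k => ?_) <;>
    fin_cases j <;> (try fin_cases k) <;> simp [weight, div_neg, inv_neg]

/-! ### Generators of `𝔍^C` -/

/-- The element with `a_j = z` and all other coordinates zero. -/
def scE (j : Fin 3) (z : Cx ℂ) : JC := (0, Pi.single j ⟨z, 0⟩)

/-- The element with `m_{kj} = z` and all other coordinates zero. -/
def vecE (j k : Fin 3) (z : Cx ℂ) : JC := (0, Pi.single j ⟨0, Pi.single k z⟩)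

/-- The idempotent of `ℂ[e₁]` with `e₁ ε = i ε`. -/
def epsP : Cx ℂ := ofPair 1 0

/-- The idempotent of `ℂ[e₁]` with `e₁ ε = -i ε`. -/
def epsM : Cx ℂ := ofPair 0 1

theorem eq_smul_eps (z : Cx ℂ) : z = plus z • epsP + minus z • epsM :=
  ext_pair (by simp [epsP, epsM]) (by simp [epsP, epsM])

theorem scE_smul (j : Fin 3) (r : ℂ) (z : Cx ℂ) : scE j (r • z) = r • scE j z := by
  refine Prod.ext (smul_zero r).symm ?_
  simp only [scE, Prod.smul_mk, ← Pi.single_smul]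
  congr 1
  exact Oct.ext rfl (smul_zero r).symm

theorem scE_add (j : Fin 3) (z w : Cx ℂ) : scE j (z + w) = scE j z + scE j w := by
  refine Prod.ext (add_zero 0).symm ?_
  simp only [scE, Prod.mk_add_mk, ← Pi.single_add]
  congr 1
  exact Oct.ext rfl (add_zero 0).symm

theorem vecE_smul (j k : Fin 3) (r : ℂ) (z : Cx ℂ) : vecE j k (r • z) = r • vecE j k z := by
  refine Prod.ext (smul_zero r).symm ?_
  simp only [vecE, Prod.smul_mk, ← Pi.single_smul]
  congr 1
  exact Oct.ext (smul_zero r).symm (Pi.single_smul (f := fun _ : Fin 3 => Cx ℂ) k r z)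

theorem vecE_add (j k : Fin 3) (z w : Cx ℂ) : vecE j k (z + w) = vecE j k z + vecE j k w := by
  refine Prod.ext (add_zero 0).symm ?_
  simp only [vecE, Prod.mk_add_mk, ← Pi.single_add]
  congr 1
  exact Oct.ext (add_zero 0).symm (Pi.single_add (f := fun _ : Fin 3 => Cx ℂ) k z w)

theorem scE_injective (j : Fin 3) : Function.Injective (scE j) := fun z w h => by
  have := congrArg (fun X : JC => (X.2 j).sc) h
  simpa [scE] using this

theorem vecE_injective (j k : Fin 3) : Function.Injective (vecE j k) := fun z w h => by
  have := congrArg (fun X : JC => (X.2 j).vec k) h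
  simpa [vecE] using this

theorem eq_sum_coord (X : JC) : X = (X.1, 0) + ∑ j, (scE j (X.2 j).sc +
    ∑ k, vecE j k ((X.2 j).vec k)) := by
  refine Prod.ext ?_ (funext fun j => Oct.ext ?_ (funext fun k => ?_))
  · simp [scE, vecE, Prod.fst_sum]
  · fin_cases j <;> simp [scE, vecE, Fin.sum_univ_three]
  · fin_cases j <;> fin_cases k <;> simp [scE, vecE, Fin.sum_univ_three]

theorem torus_scE (t : T6) (j : Fin 3) (z : Cx ℂ) :
    (torus t).val (scE j z) = scE j ((weight t).2.1 j * z) := by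
  refine Prod.ext (mul_zero _) (funext fun l => Oct.ext ?_ (funext fun k => ?_))
  · rw [torus_sc]; by_cases h : l = j
    · subst h; simp [scE]
    · simp [scE, h]
  · rw [torus_vec]; by_cases h : l = j
    · subst h; simp [scE]
    · simp [scE, h]

theorem torus_vecE (t : T6) (j k : Fin 3) (z : Cx ℂ) :
    (torus t).val (vecE j k z) = vecE j k ((weight t).2.2 j k * z) := by
  refine Prod.ext (mul_zero _) (funext fun l => Oct.ext ?_ (funext fun i => ?_))
  · rw [torus_sc]; by_cases h : l = j
    · subst h; simp [vecE]
    · simp [vecE, h]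
  · rw [torus_vec]; by_cases h : l = j
    · subst h
      by_cases h' : i = k
      · subst h'; simp [vecE]
      · simp [vecE, h']
    · simp [vecE, h]

theorem tau_scE (j : Fin 3) (z : Cx ℂ) : tau (scE j z) = scE j (conj z) := by
  refine ext_coord (fun l => ?_) (fun l => ?_) (fun l => ?_) (fun l i => ?_) (fun l i => ?_) <;>
    by_cases h : l = j <;> (try subst h) <;> simp [scE, *]

theorem tau_vecE (j k : Fin 3) (z : Cx ℂ) : tau (vecE j k z) = vecE j k (conj z) := by
  refine ext_coord (fun l => ?_) (fun l => ?_) (fun l => ?_) (fun l i => ?_) (fun l i => ?_) <;>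
    by_cases h : l = j <;> (try subst h) <;> simp [vecE, *] <;>
    by_cases h : i = k <;> (try subst h) <;> simp [*]

theorem sc_mul_sc (z w : Cx ℂ) : (⟨z, 0⟩ : Oct ℂ) * ⟨w, 0⟩ = ⟨z * w, 0⟩ := by
  refine Oct.ext ?_ ?_ <;> simp [Oct.mul_def]

theorem sc_mul_vec (z : Cx ℂ) (m : Fin 3 → Cx ℂ) :
    (⟨z, 0⟩ : Oct ℂ) * ⟨0, m⟩ = ⟨0, z • m⟩ := by
  refine Oct.ext ?_ ?_ <;> simp [Oct.mul_def]

theorem vec_mul_sc (z : Cx ℂ) (m : Fin 3 → Cx ℂ) :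
    (⟨0, m⟩ : Oct ℂ) * ⟨z, 0⟩ = ⟨0, star z • m⟩ := by
  refine Oct.ext ?_ ?_ <;> simp [Oct.mul_def]

theorem single_mul_single (k : Fin 3) (z w : Cx ℂ) :
    (⟨0, Pi.single k z⟩ : Oct ℂ) * ⟨0, Pi.single (k + 1) w⟩ =
      ⟨0, Pi.single (k + 2) (star (z * w))⟩ := by
  refine Oct.ext ?_ (funext fun i => ?_)
  · fin_cases k <;> simp [Oct.mul_def, dotProduct, Fin.sum_univ_three]
  · fin_cases k <;> fin_cases i <;> simp [Oct.mul_def, cross_apply, mul_comm]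

theorem star_vec (m : Fin 3 → Cx ℂ) : star (⟨0, m⟩ : Oct ℂ) = -⟨0, m⟩ :=
  Oct.ext (by simp) rfl

theorem oct_star_zero : star (0 : Oct ℂ) = 0 := Oct.ext (star_zero _) neg_zero

theorem freudenthal_offdiag (j : Fin 3) (x y : Oct ℂ) :
    Alb.freudenthal (0, Pi.single j x) (0, Pi.single (j + 1) y) =
      (1 / 2 : ℂ) • (0, Pi.single (j + 2) (star (x * y))) := by
  refine Prod.ext (funext fun l => ?_) (funext fun l => ?_)
  · rw [freudenthal_fst]
    fin_cases j <;> fin_cases l <;> simp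
  · rw [freudenthal_snd]
    fin_cases j <;> fin_cases l <;> simp [oct_star_zero]

theorem freudenthal_scE_scE (j : Fin 3) (z w : Cx ℂ) :
    Alb.freudenthal (scE j z) (scE (j + 1) w) = (1 / 2 : ℂ) • scE (j + 2) (star (z * w)) := by
  rw [scE, scE, freudenthal_offdiag, sc_mul_sc, scE]
  congr 3
  exact Oct.ext rfl neg_zero

theorem freudenthal_scE_vecE (j k : Fin 3) (z w : Cx ℂ) :
    Alb.freudenthal (scE j z) (vecE (j + 1) k w) = (-1 / 2 : ℂ) • vecE (j + 2) k (z * w) := by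
  rw [scE, vecE, freudenthal_offdiag, sc_mul_vec, neg_div, neg_smul, ← smul_neg, vecE]
  congr 1
  refine Prod.ext neg_zero.symm ?_
  rw [star_vec, Prod.snd_neg, ← Pi.single_neg, ← smul_eq_mul, ← Pi.single_smul]

theorem freudenthal_vecE_scE (j k : Fin 3) (z w : Cx ℂ) :
    Alb.freudenthal (vecE j k w) (scE (j + 1) z) =
      (-1 / 2 : ℂ) • vecE (j + 2) k (star z * w) := by
  rw [scE, vecE, freudenthal_offdiag, vec_mul_sc, neg_div, neg_smul, ← smul_neg, vecE]
  congr 1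
  refine Prod.ext neg_zero.symm ?_
  rw [star_vec, Prod.snd_neg, ← Pi.single_neg, ← smul_eq_mul, ← Pi.single_smul]

theorem freudenthal_vecE_vecE (j k : Fin 3) (z w : Cx ℂ) :
    Alb.freudenthal (vecE j k z) (vecE (j + 1) (k + 1) w) =
      (-1 / 2 : ℂ) • vecE (j + 2) (k + 2) (star (z * w)) := by
  rw [vecE, vecE, freudenthal_offdiag, single_mul_single, neg_div, neg_smul, ← smul_neg, vecE]
  congr 1
  refine Prod.ext neg_zero.symm ?_
  rw [star_vec, Prod.snd_neg, ← Pi.single_neg]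

/-- The elements `X` of the plane `scE j` with `X × X = 0` form the two weight lines. -/
theorem freudenthal_scE_self (j : Fin 3) (z : Cx ℂ) :
    Alb.freudenthal (scE j z) (scE j z) = (-(plus z * minus z)) • (Pi.single j 1, 0) := by
  refine Prod.ext (funext fun l => ?_) (funext fun l => ?_)
  · rw [freudenthal_fst]
    fin_cases j <;> fin_cases l <;> simp [scE] <;> ring
  · rw [freudenthal_snd]
    fin_cases j <;> fin_cases l <;> simp [scE, Oct.ext_iff]

theorem freudenthal_diag_vecE (j k : Fin 3) (z : Cx ℂ) :
    Alb.freudenthal (Pi.single j 1, 0) (vecE j k z) = (-1 / 2 : ℂ) • vecE j k z := by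
  refine Prod.ext (funext fun l => ?_) (funext fun l => ?_)
  · rw [freudenthal_fst]
    fin_cases j <;> fin_cases l <;> simp [vecE]
  · rw [freudenthal_snd]
    fin_cases j <;> fin_cases l <;> simp [vecE, Oct.ext_iff, neg_div]

/-- Six weight vectors generate `𝔍^C` under the conjugate-linear product `τ(X × Y)`. -/
theorem eq_top_of_generators {F : Submodule ℂ JC}
    (hF : ∀ X ∈ F, ∀ Y ∈ F, tau (Alb.freudenthal X Y) ∈ F)
    (h0p : scE 0 epsP ∈ F) (h0m : scE 0 epsM ∈ F) (h1p : scE 1 epsP ∈ F) (h1m : scE 1 epsM ∈ F)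
    (hv0 : vecE 0 0 epsP ∈ F) (hv1 : vecE 0 1 epsP ∈ F) : F = ⊤ := by
  have hmul : ∀ {X Y Z : JC} {r : ℂ}, r ≠ 0 → X ∈ F → Y ∈ F →
      Alb.freudenthal X Y = r • Z → tau Z ∈ F := fun {X Y Z r} hr hX hY h => by
    have := hF X hX Y hY
    rw [h, tau_smul] at this
    exact (F.smul_mem_iff (star_ne_zero.2 hr)).1 this
  have half : (1 / 2 : ℂ) ≠ 0 := by norm_num
  have half' : (-1 / 2 : ℂ) ≠ 0 := by norm_num
  have conj_conj : ∀ z, conj (conj z) = z := fun z => ext_pair (by simp) (by simp)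
  have hs0 : ∀ z, scE 0 z ∈ F := fun z => by
    rw [eq_smul_eps z, scE_add, scE_smul, scE_smul]
    exact F.add_mem (F.smul_mem _ h0p) (F.smul_mem _ h0m)
  have hs1 : ∀ z, scE 1 z ∈ F := fun z => by
    rw [eq_smul_eps z, scE_add, scE_smul, scE_smul]
    exact F.add_mem (F.smul_mem _ h1p) (F.smul_mem _ h1m)
  have hs2 : ∀ z, scE 2 z ∈ F := fun z => by
    have := hmul half (hs0 1) (hs1 (star (conj z))) (freudenthal_scE_scE 0 _ _)
    simpa [tau_scE, conj_conj] using this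
  have hs : ∀ j z, scE j z ∈ F := fun j z => by
    fin_cases j
    exacts [hs0 z, hs1 z, hs2 z]
  have hd : ∀ j, (Pi.single j 1, 0) ∈ F := fun j => by
    have := hmul (by simp) (hs j 1) (hs j 1) (freudenthal_scE_self j 1)
    rwa [show tau (Pi.single j 1, 0) = (Pi.single j 1, 0) from
      ext_coord (fun l => by by_cases h : l = j <;> simp [h])
        (by simp) (by simp) (by simp) (by simp)] at this
  have hv : ∀ k, vecE 0 k epsP ∈ F → ∀ z, vecE 0 k z ∈ F := fun k hk z => by
    have := hmul half' (hd 0) hk (freudenthal_diag_vecE 0 k _)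
    rw [tau_vecE, show conj epsP = epsM from ext_pair (by simp [epsP, epsM])
      (by simp [epsP, epsM])] at this
    rw [eq_smul_eps z, vecE_add, vecE_smul, vecE_smul]
    exact F.add_mem (F.smul_mem _ hk) (F.smul_mem _ this)
  -- the products with `scE (j + 1) 1` and `scE (j + 2) 1` move an entry along its row
  have hrow : ∀ j k, (∀ z, vecE j k z ∈ F) → ∀ l z, vecE l k z ∈ F := fun j k h l z => by
    have h2 : vecE (j + 2) k z ∈ F := by
      have := hmul half' (h (conj z)) (hs (j + 1) 1) (freudenthal_vecE_scE j k _ _)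
      simpa [tau_vecE, conj_conj] using this
    have h1 : vecE (j + 1) k z ∈ F := by
      have e := freudenthal_scE_vecE (j + 2) k 1 (conj z)
      rw [show j + 2 + 1 = j by fin_cases j <;> rfl,
        show j + 2 + 2 = j + 1 by fin_cases j <;> rfl] at e
      have := hmul half' (hs (j + 2) 1) (h (conj z)) e
      simpa [tau_vecE, conj_conj] using this
    have : l = j ∨ l = j + 1 ∨ l = j + 2 := by fin_cases j <;> fin_cases l <;> simp
    obtain rfl | rfl | rfl := this
    exacts [h z, h1, h2]
  have hr0 := hrow 0 0 (hv 0 hv0)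
  have hr1 := hrow 0 1 (hv 1 hv1)
  have hr2 := hrow 2 2 fun z => by
    have := hmul half' (hr0 0 1) (hr1 1 (star (conj z))) (freudenthal_vecE_vecE 0 0 _ _)
    simpa [tau_vecE, conj_conj] using this
  refine Submodule.eq_top_iff'.2 fun X => ?_
  rw [eq_sum_coord X]
  refine F.add_mem ?_ (F.sum_mem fun j _ => F.add_mem (hs _ _) (F.sum_mem fun k _ => ?_))
  · have : ((X.1, 0) : JC) = ∑ j, X.1 j • ((Pi.single j 1, 0) : JC) := by
      refine Prod.ext ?_ ?_
      · funext j
        fin_cases j <;> simp [Fin.sum_univ_three]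
      · simp [Prod.snd_sum]
    rw [this]
    exact F.sum_mem fun j _ => F.smul_mem _ (hd j)
  · fin_cases k
    exacts [hr0 _ _, hr1 _ _, hr2 _ _]

/-! ### Elements commuting with the involutions -/

namespace IsSignMap

variable {β : GLJC} {s g : Fin 3 → ℂ} {e : ℂ} {Y : JC}

theorem fst_eq_zero (h : IsSignMap β s g) (hY : β.val Y = e • Y) (he : 1 ≠ e) (j : Fin 3) :
    Y.1 j = 0 := by
  rw [h Y] at hY
  have h1 : Y.1 j = e * Y.1 j := congrArg (fun X : JC => X.1 j) hY
  have : (1 - e) * Y.1 j = 0 := by linear_combination h1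
  exact (mul_eq_zero.1 this).resolve_left (sub_ne_zero.2 he)

theorem sc_eq_zero (h : IsSignMap β s g) (hY : β.val Y = e • Y) (j : Fin 3) (he : s j ≠ e) :
    (Y.2 j).sc = 0 := by
  rw [h Y] at hY
  have h1 : s j • (Y.2 j).sc = e • (Y.2 j).sc := congrArg (fun X : JC => (X.2 j).sc) hY
  rw [← sub_eq_zero, ← sub_smul] at h1
  exact (smul_eq_zero.1 h1).resolve_left (sub_ne_zero.2 he)

theorem vec_eq_zero (h : IsSignMap β s g) (hY : β.val Y = e • Y) (j k : Fin 3)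
    (he : g k * s j ≠ e) : (Y.2 j).vec k = 0 := by
  rw [h Y] at hY
  have h1 : (g k * s j) • (Y.2 j).vec k = e • (Y.2 j).vec k :=
    congrArg (fun X : JC => (X.2 j).vec k) hY
  rw [← sub_eq_zero, ← sub_smul] at h1
  exact (smul_eq_zero.1 h1).resolve_left (sub_ne_zero.2 he)

theorem map_scE (h : IsSignMap β s g) (j : Fin 3) (z : Cx ℂ) :
    β.val (scE j z) = s j • scE j z := by
  rw [h, ← scE_smul]
  refine Prod.ext rfl (funext fun l => ?_)
  by_cases hl : l = j
  · subst hl; simp [scE, Oct.ext_iff, funext_iff]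
  · simp [scE, hl, Oct.ext_iff, funext_iff]

theorem map_vecE (h : IsSignMap β s g) (j k : Fin 3) (z : Cx ℂ) :
    β.val (vecE j k z) = (g k * s j) • vecE j k z := by
  rw [h, ← vecE_smul]
  refine Prod.ext rfl (funext fun l => ?_)
  by_cases hl : l = j
  · subst hl
    refine Oct.ext (by simp [vecE]) (funext fun i => ?_)
    by_cases hi : i = k
    · subst hi; simp [vecE]
    · simp [vecE, hi]
  · simp [vecE, hl, Oct.ext_iff, funext_iff]

end IsSignMap

/-- `α` commutes with `γ`, `γ'`, `σ` and `σ'`. -/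
def CommInvol (α : GLJC) : Prop :=
  α ∈ Subgroup.centralizer {gammaC, gammaC', sigmaC, sigmaC'}

theorem apply_eigen {α β : GLJC} (h : β * α = α * β) {X : JC} {e : ℂ} (hX : β.val X = e • X) :
    β.val (α.val X) = e • α.val X := by
  have h' := congrArg (fun δ : GLJC => δ.val X) h
  change β.val (α.val X) = α.val (β.val X) at h'
  rw [h', hX, map_smul]

/-- The plane of the coordinate `a_j` is a joint eigenspace of the four involutions. -/
theorem CommInvol.exists_scE {α : GLJC} (h : CommInvol α) (j : Fin 3) (z : Cx ℂ) :
    ∃ w, α.val (scE j z) = scE j w := by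
  rw [CommInvol, Subgroup.mem_centralizer_iff] at h
  have h1 := apply_eigen (h gammaC (by simp)) (isSignMap_gammaC.map_scE j z)
  have h2 := apply_eigen (h gammaC' (by simp)) (isSignMap_gammaC'.map_scE j z)
  have h3 := apply_eigen (h sigmaC (by simp)) (isSignMap_sigmaC.map_scE j z)
  have h4 := apply_eigen (h sigmaC' (by simp)) (isSignMap_sigmaC'.map_scE j z)
  generalize α.val (scE j z) = Y at h1 h2 h3 h4
  refine ⟨(Y.2 j).sc, Prod.ext (funext fun l => ?_) (funext fun l => Oct.ext ?_
    (funext fun k => ?_))⟩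
  · fin_cases j
    · exact isSignMap_sigmaC'.fst_eq_zero h4 (by norm_num) _
    · exact isSignMap_sigmaC.fst_eq_zero h3 (by norm_num) _
    · exact isSignMap_sigmaC.fst_eq_zero h3 (by norm_num) _
  · by_cases hl : l = j
    · subst hl; simp [scE]
    · have : (Y.2 l).sc = 0 := by
        revert hl
        fin_cases j <;> fin_cases l <;> intro hl <;>
        first
        | exact absurd rfl hl
        | (refine isSignMap_sigmaC.sc_eq_zero h3 _ ?_; norm_num; done)
        | (refine isSignMap_sigmaC'.sc_eq_zero h4 _ ?_; norm_num; done)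
      simp [scE, hl, this]
  · have : (Y.2 l).vec k = 0 := by
      fin_cases k
      · exact isSignMap_gammaC'.vec_eq_zero h2 _ _ (by norm_num)
      · exact isSignMap_gammaC.vec_eq_zero h1 _ _ (by norm_num)
      · exact isSignMap_gammaC.vec_eq_zero h1 _ _ (by norm_num)
    rw [this]
    by_cases hl : l = j
    · subst hl; simp [scE]
    · simp [scE, hl]

/-- The plane of the coordinate `m_{kj}` is a joint eigenspace of the four involutions. -/
theorem CommInvol.exists_vecE {α : GLJC} (h : CommInvol α) (j k : Fin 3) (z : Cx ℂ) :
    ∃ w, α.val (vecE j k z) = vecE j k w := by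
  rw [CommInvol, Subgroup.mem_centralizer_iff] at h
  have h1 := apply_eigen (h gammaC (by simp)) (isSignMap_gammaC.map_vecE j k z)
  have h2 := apply_eigen (h gammaC' (by simp)) (isSignMap_gammaC'.map_vecE j k z)
  have h3 := apply_eigen (h sigmaC (by simp)) (isSignMap_sigmaC.map_vecE j k z)
  have h4 := apply_eigen (h sigmaC' (by simp)) (isSignMap_sigmaC'.map_vecE j k z)
  generalize α.val (vecE j k z) = Y at h1 h2 h3 h4
  refine ⟨(Y.2 j).vec k, Prod.ext (funext fun l => ?_) (funext fun l => Oct.ext ?_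
    (funext fun i => ?_))⟩
  · fin_cases k
    · exact isSignMap_gammaC'.fst_eq_zero h2 (by norm_num) _
    · exact isSignMap_gammaC.fst_eq_zero h1 (by norm_num) _
    · exact isSignMap_gammaC.fst_eq_zero h1 (by norm_num) _
  · have : (Y.2 l).sc = 0 := by
      fin_cases k
      · exact isSignMap_gammaC'.sc_eq_zero h2 _ (by norm_num)
      · exact isSignMap_gammaC.sc_eq_zero h1 _ (by norm_num)
      · exact isSignMap_gammaC.sc_eq_zero h1 _ (by norm_num)
    rw [this]
    by_cases hl : l = j
    · subst hl; simp [vecE]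
    · simp [vecE, hl]
  · by_cases hl : l = j
    · subst hl
      by_cases hi : i = k
      · subst hi; simp [vecE]
      · have : (Y.2 l).vec i = 0 := by
          revert hi
          fin_cases k <;> fin_cases i <;> intro hi <;>
          first
          | exact absurd rfl hi
          | (refine isSignMap_gammaC.vec_eq_zero h1 _ _ ?_; norm_num; done)
          | (refine isSignMap_gammaC'.vec_eq_zero h2 _ _ ?_; norm_num; done)
        simp [vecE, hi, this]
    · have : (Y.2 l).vec i = 0 := by
        revert hl
        fin_cases j <;> fin_cases l <;> intro hl <;>
        first
        | exact absurd rfl hl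
        | (refine isSignMap_sigmaC.vec_eq_zero h3 _ _ ?_
           rw [Pi.one_apply, Pi.one_apply]; norm_num; done)
        | (refine isSignMap_sigmaC'.vec_eq_zero h4 _ _ ?_
           rw [Pi.one_apply, Pi.one_apply]; norm_num; done)
      simp [vecE, hl, this]

/-! ### The common fixed-point subgroup -/

theorem tau_zero : tau 0 = 0 := by simpa using tau_smul 0 0

/-- Elements of `E₆` preserve vanishing products. -/
theorem freudenthal_eq_zero {α : GLJC} (hα : α ∈ E6) {X Y : JC} (h : Alb.freudenthal X Y = 0) :
    Alb.freudenthal (α.val X) (α.val Y) = 0 := by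
  rw [(hα X Y).1, h, tau_zero, map_zero, tau_zero]

theorem freudenthal_ne_zero {α : GLJC} (hα : α ∈ E6) {X Y : JC}
    (h : Alb.freudenthal X Y ≠ 0) : Alb.freudenthal (α.val X) (α.val Y) ≠ 0 := fun h' => h <| by
  have h1 := freudenthal_eq_zero (E6.inv_mem hα) h'
  have key : ∀ Z : JC, α⁻¹.val (α.val Z) = Z := fun Z =>
    congrArg (fun δ : JC →L[ℂ] JC => δ Z) α.inv_mul
  rwa [key, key] at h1

theorem scE_self_eq_zero_iff (j : Fin 3) (z : Cx ℂ) :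
    Alb.freudenthal (scE j z) (scE j z) = 0 ↔ plus z * minus z = 0 := by
  rw [freudenthal_scE_self, smul_eq_zero, neg_eq_zero, or_iff_left]
  intro h
  have := congrFun (congrArg Prod.fst h) j
  simp at this

theorem map_scE_norm {α : GLJC} (hα : α ∈ E6) {j : Fin 3} {z w : Cx ℂ}
    (h : α.val (scE j z) = scE j w) : plus w * minus w = 0 ↔ plus z * minus z = 0 := by
  rw [← scE_self_eq_zero_iff j, ← scE_self_eq_zero_iff j, ← h]
  exact ⟨fun h' => by_contra fun h'' => freudenthal_ne_zero hα h'' h', freudenthal_eq_zero hα⟩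

theorem herm_scE (j : Fin 3) (z : Cx ℂ) :
    herm (scE j z) (scE j z) = star (minus z) * minus z + star (plus z) * plus z := by
  rw [herm_eq]
  fin_cases j <;> simp [scE, Fin.sum_univ_three]

theorem herm_vecE (j k : Fin 3) (z : Cx ℂ) :
    herm (vecE j k z) (vecE j k z) = star (minus z) * minus z + star (plus z) * plus z := by
  rw [herm_eq]
  fin_cases j <;> fin_cases k <;> simp [vecE, Fin.sum_univ_three]

theorem exists_circle {u : ℂ} (h : star u * u = 1) : ∃ c : Circle, (c : ℂ) = u := by
  refine ⟨⟨u, mem_sphere_zero_iff_norm.2 ?_⟩, rfl⟩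
  rw [← sq_eq_sq₀ (norm_nonneg _) zero_le_one, one_pow, ← ofReal_inj, ofReal_pow, ← conj_mul',
    ofReal_one]
  exact h

theorem epsP_mul_epsM : epsP * epsM = 0 := ext_pair (by simp [epsP, epsM]) (by simp [epsP, epsM])

theorem star_epsP : star epsP = epsM := ext_pair (by simp [epsP, epsM]) (by simp [epsP, epsM])

theorem scE_zero (j : Fin 3) : scE j 0 = 0 := by simpa using scE_smul j 0 0

theorem vecE_zero (j k : Fin 3) : vecE j k 0 = 0 := by simpa using vecE_smul j k 0 0

/-- Two elements of `E₆` that agree on six weight vectors are equal. -/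
theorem E6_ext {α β : GLJC} (hα : α ∈ E6) (hβ : β ∈ E6)
    (h0p : α.val (scE 0 epsP) = β.val (scE 0 epsP)) (h0m : α.val (scE 0 epsM) = β.val (scE 0 epsM))
    (h1p : α.val (scE 1 epsP) = β.val (scE 1 epsP)) (h1m : α.val (scE 1 epsM) = β.val (scE 1 epsM))
    (hv0 : α.val (vecE 0 0 epsP) = β.val (vecE 0 0 epsP))
    (hv1 : α.val (vecE 0 1 epsP) = β.val (vecE 0 1 epsP)) : α = β := by
  have key := eq_top_of_generators
    (F := LinearMap.eqLocus α.val.toLinearMap β.val.toLinearMap) (fun X hX Y hY => ?_)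
    h0p h0m h1p h1m hv0 hv1
  · refine Units.ext (ContinuousLinearMap.ext fun X => ?_)
    have : X ∈ LinearMap.eqLocus α.val.toLinearMap β.val.toLinearMap := key ▸ Submodule.mem_top
    exact this
  · have hX' : α.val X = β.val X := hX
    have hY' : α.val Y = β.val Y := hY
    have h1 := (hα X Y).1
    rw [hX', hY', (hβ X Y).1] at h1
    exact ((Function.LeftInverse.injective tau_tau) h1).symm

/-- An element of the fixed-point subgroup that preserves the line of the weight vector
`scE 0 epsP` is diagonal. -/
theorem exists_torus_of_minus_eq_zero {α : GLJC} (hα : α ∈ E6) (hc : CommInvol α) {w : Cx ℂ}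
    (hw : α.val (scE 0 epsP) = scE 0 w) (hw' : minus w = 0) : ∃ t, α = torus t := by
  have hP : plus epsP = 1 ∧ minus epsP = 0 := by simp [epsP]
  have hM : plus epsM = 0 ∧ minus epsM = 1 := by simp [epsM]
  obtain ⟨w', hw2⟩ := hc.exists_scE 0 epsM
  obtain ⟨x, hx⟩ := hc.exists_scE 1 epsP
  obtain ⟨x', hx2⟩ := hc.exists_scE 1 epsM
  obtain ⟨y, hy⟩ := hc.exists_vecE 0 0 epsP
  obtain ⟨y', hy2⟩ := hc.exists_vecE 0 1 epsP
  have unit_sc : ∀ {j z u}, α.val (scE j z) = scE j u →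
      star (minus u) * minus u + star (plus u) * plus u =
        star (minus z) * minus z + star (plus z) * plus z := fun {j z u} h => by
    rw [← herm_scE j, ← herm_scE j, ← h, (hα _ _).2]
  have unit_vec : ∀ {j k z u}, α.val (vecE j k z) = vecE j k u →
      star (minus u) * minus u + star (plus u) * plus u =
        star (minus z) * minus z + star (plus z) * plus z := fun {j k z u} h => by
    rw [← herm_vecE j k, ← herm_vecE j k, ← h, (hα _ _).2]
  -- `scE 0 1` has nonzero norm, and so has its image `scE 0 (w + w')`
  have hw2' : plus w' = 0 := by
    have h1 := (map_scE_norm hα hw2).2 (by simp [hM])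
    have h2 : α.val (scE 0 (epsP + epsM)) = scE 0 (w + w') := by
      rw [scE_add, map_add, hw, hw2, scE_add]
    have h3 := mt (map_scE_norm hα h2).1 (by simp [hP, hM])
    rw [map_add minus, hw', zero_add] at h3
    exact (mul_eq_zero.1 h1).resolve_right (right_ne_zero_of_mul h3)
  obtain ⟨a, ha⟩ := exists_circle (u := plus w) (by simpa [hw', hP] using unit_sc hw)
  obtain ⟨b, hb⟩ := exists_circle (u := minus w') (by simpa [hw2', hM] using unit_sc hw2)
  have hx' : minus x = 0 := by
    have h1 := freudenthal_eq_zero hα (X := scE 0 epsM) (Y := scE 1 epsP) (by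
      refine (freudenthal_scE_scE 0 _ _).trans ?_
      rw [mul_comm, epsP_mul_epsM, star_zero, scE_zero, smul_zero])
    rw [hw2, hx] at h1
    replace h1 := (freudenthal_scE_scE 0 w' x).symm.trans h1
    rw [smul_eq_zero, or_iff_right (by norm_num), ← scE_zero 2] at h1
    have h2 := congrArg plus (scE_injective _ h1)
    simp only [plus_star, map_mul, map_zero] at h2
    exact (mul_eq_zero.1 h2).resolve_left (hb ▸ b.coe_ne_zero)
  have hx2' : plus x' = 0 := by
    have h1 := freudenthal_eq_zero hα (X := scE 0 epsP) (Y := scE 1 epsM) (by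
      refine (freudenthal_scE_scE 0 _ _).trans ?_
      rw [epsP_mul_epsM, star_zero, scE_zero, smul_zero])
    rw [hw, hx2] at h1
    replace h1 := (freudenthal_scE_scE 0 w x').symm.trans h1
    rw [smul_eq_zero, or_iff_right (by norm_num), ← scE_zero 2] at h1
    have h2 := congrArg minus (scE_injective _ h1)
    simp only [minus_star, map_mul, map_zero] at h2
    exact (mul_eq_zero.1 h2).resolve_left (ha ▸ a.coe_ne_zero)
  obtain ⟨c, hc1⟩ := exists_circle (u := plus x) (by simpa [hx', hP] using unit_sc hx)
  obtain ⟨d, hd⟩ := exists_circle (u := minus x') (by simpa [hx2', hM] using unit_sc hx2)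
  have hvec : ∀ k v, α.val (vecE 0 k epsP) = vecE 0 k v → minus v = 0 := fun k v hv => by
    have h1 := freudenthal_eq_zero hα (X := vecE 0 k epsP) (Y := scE 1 epsP) (by
      refine (freudenthal_vecE_scE 0 k _ _).trans ?_
      rw [star_epsP, mul_comm, epsP_mul_epsM, vecE_zero, smul_zero])
    rw [hv, hx] at h1
    replace h1 := (freudenthal_vecE_scE 0 k x v).symm.trans h1
    rw [smul_eq_zero, or_iff_right (by norm_num), ← vecE_zero 2 k] at h1
    have h2 := congrArg minus (vecE_injective _ _ h1)
    simp only [minus_star, map_mul, map_zero] at h2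
    exact (mul_eq_zero.1 h2).resolve_left (hc1 ▸ c.coe_ne_zero)
  have hy' := hvec 0 y hy
  have hy2' := hvec 1 y' hy2
  obtain ⟨p, hp⟩ := exists_circle (u := plus y) (by simpa [hy', hP] using unit_vec hy)
  obtain ⟨q, hq⟩ := exists_circle (u := plus y') (by simpa [hy2', hP] using unit_vec hy2)
  refine ⟨![p / a, q / a, a, c, b⁻¹, d⁻¹], E6_ext hα (torus_mem _) ?_ ?_ ?_ ?_ ?_ ?_⟩
  · rw [hw, torus_scE]
    exact congrArg _ (ext_pair (by simp [weight, hP, ha]) (by simp [hP, hw']))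
  · rw [hw2, torus_scE]
    exact congrArg _ (ext_pair (by simp [hM, hw2']) (by simp [weight, hM, hb]))
  · rw [hx, torus_scE]
    exact congrArg _ (ext_pair (by simp [weight, hP, hc1]) (by simp [hP, hx']))
  · rw [hx2, torus_scE]
    exact congrArg _ (ext_pair (by simp [hM, hx2']) (by simp [weight, hM, hd]))
  · rw [hy, torus_vecE]
    exact congrArg _ (ext_pair (by simp [weight, hP, hp]) (by simp [hP, hy']))
  · rw [hy2, torus_vecE]
    exact congrArg _ (ext_pair (by simp [weight, hP, hq]) (by simp [hP, hy2']))

/-- The four involutions are torus elements fixed by `theta`, so that both the torus and `γ₁`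
commute with them. -/
theorem commInvol_of_commute {α : GLJC} (h : ∀ t, theta t = t → torus t * α = α * torus t) :
    CommInvol α := by
  rw [CommInvol, Subgroup.mem_centralizer_iff]
  intro β hβ
  have hθ : ∀ t : T6, (∀ j, (t j)⁻¹ = t j) → t 4 = t 2 → t 5 = t 3 → theta t = t :=
    fun t ht h4 h5 => funext fun j => by fin_cases j <;> simp [theta, ht, h4, h5]
  rcases hβ with rfl | rfl | rfl | rfl
  · rw [gammaC_eq]
    exact h _ (hθ _ (fun j => by fin_cases j <;> simp [inv_neg]) rfl rfl)
  · rw [gammaC'_eq]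
    exact h _ (hθ _ (fun j => by fin_cases j <;> simp [inv_neg]) rfl rfl)
  · rw [sigmaC_eq]
    exact h _ (hθ _ (fun j => by fin_cases j <;> simp [inv_neg]) rfl rfl)
  · rw [sigmaC'_eq]
    exact h _ (hθ _ (fun j => by fin_cases j <;> simp [inv_neg]) rfl rfl)

theorem commInvol_torus (t : T6) : CommInvol (torus t) :=
  commInvol_of_commute fun s _ => by rw [← map_mul, ← map_mul, mul_comm]

theorem commInvol_gamma1C : CommInvol gamma1C :=
  commInvol_of_commute fun s hs => by rw [gamma1C_mul_torus, hs]

/-- Every element of `E₆` that commutes with the four involutions lies in the torus or in its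
coset of `γ₁`, according to which weight line of the plane `scE 0` is the image of the line of
`scE 0 epsP`. -/
theorem exists_torus_or {α : GLJC} (hα : α ∈ E6) (hc : CommInvol α) :
    ∃ t, α = torus t ∨ α = torus t * gamma1C := by
  obtain ⟨w, hw⟩ := hc.exists_scE 0 epsP
  have h1 := (map_scE_norm hα hw).2 (by simp [epsP])
  rcases mul_eq_zero.1 h1 with h | h
  · obtain ⟨t, ht⟩ := exists_torus_of_minus_eq_zero (E6.mul_mem gamma1C_mem hα)
      (Subgroup.mul_mem _ commInvol_gamma1C hc) (w := star w) (by
        change gamma1C.val (α.val (scE 0 epsP)) = _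
        rw [hw]
        refine Prod.ext rfl (funext fun l => Oct.ext ?_ (funext fun k => ?_))
        · rw [gamma1C_sc]; fin_cases l <;> simp [scE]
        · rw [gamma1C_vec]; fin_cases l <;> simp [scE]) (by simpa using h)
    refine ⟨theta t, Or.inr ?_⟩
    rw [← gamma1C_mul_torus, ← ht, ← mul_assoc, gamma1C_mul_self, one_mul]
  · obtain ⟨t, ht⟩ := exists_torus_of_minus_eq_zero hα hc hw h
    exact ⟨t, Or.inl ht⟩

theorem torus_injective : Function.Injective torus := fun t t' h => by
  have hsc : ∀ j, (weight t).2.1 j = (weight t').2.1 j := fun j => by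
    have := congrArg (fun α : GLJC => α.val (scE j 1)) h
    simpa only [torus_scE, mul_one, (scE_injective j).eq_iff] using this
  have hvec : ∀ j k, (weight t).2.2 j k = (weight t').2.2 j k := fun j k => by
    have := congrArg (fun α : GLJC => α.val (vecE j k 1)) h
    simpa only [torus_vecE, mul_one, (vecE_injective j k).eq_iff] using this
  have h2 : t 2 = t' 2 := Circle.ext (by simpa [weight] using congrArg plus (hsc 0))
  have h3 : t 3 = t' 3 := Circle.ext (by simpa [weight] using congrArg plus (hsc 1))
  have h4 : t 4 = t' 4 := Circle.ext (by simpa [weight] using congrArg minus (hsc 0))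
  have h5 : t 5 = t' 5 := Circle.ext (by simpa [weight] using congrArg minus (hsc 1))
  have h0 : t 0 = t' 0 := Circle.ext (by simpa [weight, h2] using congrArg plus (hvec 0 0))
  have h1 : t 1 = t' 1 := Circle.ext (by simpa [weight, h2] using congrArg plus (hvec 0 1))
  funext j
  fin_cases j
  exacts [h0, h1, h2, h3, h4, h5]

theorem torus_ne_gamma1C (t : T6) : torus t ≠ gamma1C := fun h => by
  have h1 := congrArg (fun α : GLJC => plus ((α.val (scE 0 epsM)).2 0).sc) h
  simp only [torus_sc, gamma1C_sc] at h1
  simp [scE, epsM] at h1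

/-! ### Topology -/

theorem continuous_JC {T : Type*} [TopologicalSpace T] {f : T → JC}
    (h₁ : ∀ j, Continuous fun t => (f t).1 j)
    (h₂ : ∀ j, Continuous fun t => plus ((f t).2 j).sc)
    (h₃ : ∀ j, Continuous fun t => minus ((f t).2 j).sc)
    (h₄ : ∀ j k, Continuous fun t => plus (((f t).2 j).vec k))
    (h₅ : ∀ j k, Continuous fun t => minus (((f t).2 j).vec k)) : Continuous f := by
  refine Continuous.prodMk (f := fun t => (f t).1) (g := fun t => (f t).2)
    (continuous_pi h₁) (continuous_pi fun j => continuous_induced_rng.2 ?_)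
  change Continuous fun t => (((((f t).2 j).sc.re, ((f t).2 j).sc.im),
    fun k => ((((f t).2 j).vec k).re, (((f t).2 j).vec k).im)) : (ℂ × ℂ) × (Fin 3 → ℂ × ℂ))
  simp only [re_eq, im_eq]
  have := h₂ j; have := h₃ j; have := h₄ j; have := h₅ j
  fun_prop

theorem continuous_circle_coe : Continuous ((↑) : Circle → ℂ) := continuous_subtype_val

theorem continuous_weight_fst (j : Fin 3) : Continuous fun t => (weight t).1 j := by
  refine continuous_circle_coe.comp ?_
  fin_cases j <;> simp only [Fin.zero_eta, Fin.mk_one, Fin.reduceFinMk, Matrix.cons_val] <;>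
    fun_prop

theorem continuous_weight_sc (j : Fin 3) : Continuous (fun t => plus ((weight t).2.1 j)) ∧
    Continuous fun t => minus ((weight t).2.1 j) := by
  fin_cases j <;>
    simp only [weight, Fin.zero_eta, Fin.mk_one, Fin.reduceFinMk, Matrix.cons_val, plus_ofPair,
      minus_ofPair] <;>
    exact ⟨continuous_circle_coe.comp (by fun_prop), continuous_circle_coe.comp (by fun_prop)⟩

theorem continuous_weight_vec (j k : Fin 3) : Continuous (fun t => plus ((weight t).2.2 j k)) ∧
    Continuous fun t => minus ((weight t).2.2 j k) := by
  fin_cases j <;> fin_cases k <;>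
    simp only [weight, Fin.zero_eta, Fin.mk_one, Fin.reduceFinMk, Matrix.cons_val, plus_ofPair,
      minus_ofPair] <;>
    exact ⟨continuous_circle_coe.comp (by fun_prop), continuous_circle_coe.comp (by fun_prop)⟩

theorem continuous_torus : Continuous torus := by
  have h : Continuous fun t => (torus t).val := by
    refine continuous_clm_apply.2 fun X => continuous_JC (fun j => ?_) (fun j => ?_) (fun j => ?_)
      (fun j k => ?_) (fun j k => ?_)
    · exact (continuous_weight_fst j).mul continuous_const
    · simp only [torus_sc, map_mul]
      exact (continuous_weight_sc j).1.mul continuous_const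
    · simp only [torus_sc, map_mul]
      exact (continuous_weight_sc j).2.mul continuous_const
    · simp only [torus_vec, map_mul]
      exact (continuous_weight_vec j k).1.mul continuous_const
    · simp only [torus_vec, map_mul]
      exact (continuous_weight_vec j k).2.mul continuous_const
  refine Units.continuous_iff.2 ⟨h, ?_⟩
  simp only [← map_inv]
  exact h.comp continuous_inv

/-- An injective continuous homomorphism from a compact group to a Hausdorff group is an
isomorphism of topological groups onto its range. -/
def rangeEquiv {T G : Type*} [Group T] [TopologicalSpace T] [CompactSpace T] [Group G]
    [TopologicalSpace G] [T2Space G] {f : T →* G} (hf : Continuous f)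
    (hi : Function.Injective f) : f.range ≃ₜ* T :=
  let H : T ≃ₜ f.range := Continuous.homeoOfEquivCompactToT2
    (f := (MonoidHom.ofInjective hi).toEquiv) (hf.subtype_mk _)
  ContinuousMulEquiv.symm { MonoidHom.ofInjective hi with
    continuous_toFun := H.continuous
    continuous_invFun := H.symm.continuous }

/-! ### The isomorphism with the semidirect product -/

/-- The torus as a map into `(E₆)^{γ, γ', σ, σ'}`. -/
def torusFix : T6 →* fixE6 :=
  (torus.codRestrict E6 torus_mem).codRestrict fixE6 fun t =>
    Subgroup.mem_subgroupOf.2 (commInvol_torus t)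

/-- `γ₁` as an element of `(E₆)^{γ, γ', σ, σ'}`. -/
def gammaFix : fixE6 := ⟨⟨gamma1C, gamma1C_mem⟩, Subgroup.mem_subgroupOf.2 commInvol_gamma1C⟩

theorem fixE6_ext {g h : fixE6} (H : ((g : E6) : GLJC) = ((h : E6) : GLJC)) : g = h :=
  Subtype.ext (Subtype.ext H)

theorem gammaFix_mul_self : gammaFix * gammaFix = 1 := fixE6_ext gamma1C_mul_self

/-- The homomorphism from `ℤ₂` with image `{1, γ₁}`. -/
def gammaHom : Multiplicative (ZMod 2) →* fixE6 where
  toFun s := if s = 1 then 1 else gammaFix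
  map_one' := by simp
  map_mul' s t := by
    have h : ∀ s : Multiplicative (ZMod 2), s = 1 ∨ s = Multiplicative.ofAdd 1 := by decide
    have h1 : (Multiplicative.ofAdd 1 : Multiplicative (ZMod 2)) ≠ 1 := by decide
    have h2 : (Multiplicative.ofAdd 1 * Multiplicative.ofAdd 1 : Multiplicative (ZMod 2)) = 1 := by
      decide
    rcases h s with rfl | rfl <;> rcases h t with rfl | rfl <;> simp [h1, h2, gammaFix_mul_self]

theorem gammaHom_eq {s : Multiplicative (ZMod 2)} (hs : s ≠ 1) : gammaHom s = gammaFix :=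
  if_neg hs

/-- The homomorphism `U(1)^{×6} ⋊ ℤ₂ → (E₆)^{γ, γ', σ, σ'}`. -/
def semidirectHom : T6 ⋊[thetaHom] Multiplicative (ZMod 2) →* fixE6 :=
  SemidirectProduct.lift torusFix gammaHom fun s => MonoidHom.ext fun t => by
    change torusFix (thetaHom s t) = gammaHom s * torusFix t * (gammaHom s)⁻¹
    rw [eq_mul_inv_iff_mul_eq]
    by_cases hs : s = 1
    · simp [hs]
    · have h1 : thetaHom s = theta := if_neg hs
      have h2 := gammaHom_eq hs
      rw [h1, h2]
      exact fixE6_ext (gamma1C_mul_torus t).symm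

theorem semidirectHom_apply (x : T6 ⋊[thetaHom] Multiplicative (ZMod 2)) :
    semidirectHom x = torusFix x.left * gammaHom x.right := rfl

theorem semidirectHom_injective : Function.Injective semidirectHom := by
  refine (injective_iff_map_eq_one _).2 fun x hx => ?_
  rw [semidirectHom_apply] at hx
  by_cases hs : x.right = 1
  · rw [hs, map_one, mul_one] at hx
    have h1 : torus x.left = torus 1 := by
      rw [map_one]
      exact congrArg (fun g : fixE6 => ((g : E6) : GLJC)) hx
    exact SemidirectProduct.ext (torus_injective h1) hs
  · have h2 := gammaHom_eq hs
    rw [h2, mul_eq_one_iff_eq_inv, inv_eq_of_mul_eq_one_left gammaFix_mul_self] at hx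
    exact absurd (congrArg (fun g : fixE6 => ((g : E6) : GLJC)) hx) (torus_ne_gamma1C _)

theorem semidirectHom_surjective : Function.Surjective semidirectHom := fun g => by
  obtain ⟨t, ht | ht⟩ := exists_torus_or (g : E6).2 (Subgroup.mem_subgroupOf.1 g.2)
  · refine ⟨SemidirectProduct.inl t, ?_⟩
    rw [semidirectHom_apply, SemidirectProduct.left_inl, SemidirectProduct.right_inl, map_one,
      mul_one]
    exact fixE6_ext ht.symm
  · refine ⟨⟨t, Multiplicative.ofAdd 1⟩, ?_⟩
    have h := gammaHom_eq (s := Multiplicative.ofAdd 1) (by decide)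
    rw [semidirectHom_apply, h]
    exact fixE6_ext ht.symm

/-- The group isomorphism `(E₆)^{γ, γ', σ, σ'} ≅ U(1)^{×6} ⋊ ℤ₂`. -/
def fixEquiv : fixE6 ≃* T6 ⋊[thetaHom] Multiplicative (ZMod 2) :=
  (MulEquiv.ofBijective semidirectHom ⟨semidirectHom_injective, semidirectHom_surjective⟩).symm

theorem fixEquiv_symm_apply (x : T6 ⋊[thetaHom] Multiplicative (ZMod 2)) :
    fixEquiv.symm x = torusFix x.left * gammaHom x.right := rfl

theorem continuous_torusFix : Continuous torusFix :=
  (continuous_torus.subtype_mk _).subtype_mk _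

theorem isHomeomorph_fixEquiv :
    IsHomeomorph fun g : fixE6 => ((fixEquiv g).left, (fixEquiv g).right) := by
  let E : T6 × Multiplicative (ZMod 2) ≃ fixE6 :=
    SemidirectProduct.equivProd.symm.trans fixEquiv.symm.toEquiv
  have hE : Continuous E := by
    change Continuous fun p : T6 × Multiplicative (ZMod 2) => torusFix p.1 * gammaHom p.2
    exact (continuous_torusFix.comp continuous_fst).mul
      ((continuous_of_discreteTopology (f := gammaHom)).comp continuous_snd)
  exact (Continuous.homeoOfEquivCompactToT2 hE).symm.isHomeomorph

/-! ### The identity component -/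

/-- The torus is connected, and the `ℤ₂`-component is constant on connected sets. -/
theorem connectedComponentOfOne_fixE6 :
    Subgroup.connectedComponentOfOne fixE6 = torusFix.range := by
  refine le_antisymm (fun g hg => ?_) ?_
  · have hc : Continuous fun g : fixE6 => (fixEquiv g).right :=
      continuous_snd.comp isHomeomorph_fixEquiv.continuous
    have h : (fixEquiv g).right = (fixEquiv 1).right :=
      isPreconnected_connectedComponent.constant hc.continuousOn hg mem_connectedComponent
    rw [map_one, SemidirectProduct.one_right] at h
    refine ⟨(fixEquiv g).left, ?_⟩
    conv_rhs => rw [← fixEquiv.symm_apply_apply g, fixEquiv_symm_apply, h, map_one, mul_one]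
  · have : IsPreconnected (Set.range torusFix) := isPreconnected_range continuous_torusFix
    exact this.subset_connectedComponent ⟨1, map_one _⟩

theorem IsTorus.connectedSpace {G : Type*} [Group G] [TopologicalSpace G] {H : Subgroup G}
    (hH : IsTorus H) : ConnectedSpace H := by
  obtain ⟨n, ⟨e⟩⟩ := hH
  exact e.symm.surjective.connectedSpace e.symm.continuous

theorem IsTorus.mul_comm {G : Type*} [Group G] [TopologicalSpace G] {H : Subgroup G}
    (hH : IsTorus H) {g h : G} (hg : g ∈ H) (hh : h ∈ H) : g * h = h * g := by
  obtain ⟨n, ⟨e⟩⟩ := hH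
  have : (⟨g, hg⟩ * ⟨h, hh⟩ : H) = ⟨h, hh⟩ * ⟨g, hg⟩ :=
    e.injective (by rw [map_mul, map_mul, _root_.mul_comm])
  exact congrArg Subtype.val this

/-- The identity component of the fixed-point subgroup is a maximal torus: it contains the four
involutions, so that a torus containing it lies in the fixed-point subgroup. -/
theorem isMaximalTorus_connectedComponent :
    IsMaximalTorus ((Subgroup.connectedComponentOfOne fixE6).map fixE6.subtype) := by
  have hmem : ∀ t, (⟨torus t, torus_mem t⟩ : E6) ∈
      (Subgroup.connectedComponentOfOne fixE6).map fixE6.subtype := fun t => by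
    rw [connectedComponentOfOne_fixE6]
    exact ⟨torusFix t, ⟨t, rfl⟩, rfl⟩
  constructor
  · rw [connectedComponentOfOne_fixE6, MonoidHom.map_range]
    exact ⟨6, ⟨rangeEquiv (continuous_subtype_val.comp continuous_torusFix)
      fun t t' h => torus_injective (congrArg Subtype.val h)⟩⟩
  · intro H hH hle g hg
    have hfix : ∀ h ∈ H, h ∈ fixE6 := fun h hh => Subgroup.mem_subgroupOf.2 <|
      commInvol_of_commute fun t _ =>
        congrArg Subtype.val (hH.mul_comm (hle (hmem t)) hh)
    have := hH.connectedSpace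
    have hc : Continuous fun h : H => (⟨h, hfix h h.2⟩ : fixE6) :=
      continuous_subtype_val.subtype_mk _
    exact ⟨⟨g, hfix g hg⟩, (isPreconnected_range hc).subset_connectedComponent ⟨1, rfl⟩
      ⟨⟨g, hg⟩, rfl⟩, rfl⟩

end ExcE6

end

open ExcE6 in
theorem theorem3p3 :
    -- the four involutions lie in `E₆`
    (gammaC ∈ E6 ∧ gammaC' ∈ E6 ∧ sigmaC ∈ E6 ∧ sigmaC' ∈ E6) ∧
    -- the identity component of the common fixed-point subgroup is the 6-torus
    Nonempty (Subgroup.connectedComponentOfOne fixE6 ≃ₜ* (Fin 6 → Circle)) ∧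
    -- and it is a maximal torus of `E₆`
    IsMaximalTorus ((Subgroup.connectedComponentOfOne fixE6).map fixE6.subtype) ∧
    -- the whole fixed-point subgroup is `U(1)^{×6} ⋊ ℤ₂` as a topological group,
    -- with `ℤ₂ = {1, γ₁}`
    ∃ e : fixE6 ≃* (Fin 6 → Circle) ⋊[thetaHom] Multiplicative (ZMod 2),
      IsHomeomorph (fun g => ((e g).left, (e g).right)) ∧
      ((e.symm (SemidirectProduct.inr (Multiplicative.ofAdd 1)) : E6) : GLJC) = gamma1C := by
  refine ⟨⟨gammaC_eq ▸ torus_mem _, gammaC'_eq ▸ torus_mem _, sigmaC_eq ▸ torus_mem _,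
    sigmaC'_eq ▸ torus_mem _⟩, ?_, isMaximalTorus_connectedComponent, fixEquiv,
    isHomeomorph_fixEquiv, ?_⟩
  · rw [connectedComponentOfOne_fixE6]
    exact ⟨rangeEquiv continuous_torusFix fun t t' h =>
      torus_injective (congrArg (fun g : fixE6 => ((g : E6) : GLJC)) h)⟩
  · have h := gammaHom_eq (s := Multiplicative.ofAdd 1) (by decide)
    rw [fixEquiv_symm_apply, SemidirectProduct.left_inr, SemidirectProduct.right_inr, map_one,
      one_mul, h]
    rfl
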